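/- For $A\in \mathfrak{sl}(n,\mathbb C)$ write $A^*=\overline A^{T}$, $|A|^2=\mathrm{tr}(AA^*)$, and let $\mathcal O_A=\{gAg^{-1}: g\in SL(n,\mathbb C)\}$. Put $Z=\{A\in \mathfrak{sl}(n,\mathbb C): |A|^4-|\mathrm{tr}(A^2)|^2=0\}$, $W=\{A\in \mathfrak{sl}(n,\mathbb C): [A,A^*]=0\}$, and for $A\in \mathfrak{sl}(n,\mathbb C)\setminus Z$ $$K(A)=\frac{|[A,A^*]|^2}{|A|^4-|\mathrm{tr}(A^2)|^2}.$$ For $m\ge 1$ let $j_m:\mathfrak{sl}(2,\mathbb C)\to \mathfrak{sl}(m,\mathbb C)$ be the irreducible representation sending $\begin{pmatrix}0&1\\0&0\end{pmatrix}$, $\begin{pmatrix}0&0\\1&0\end{pmatrix}$, $\begin{pmatrix}1&0\\0&-1\end{pmatrix}$ respectively to the matrix $e_m$ with entries $\sqrt{k(m-k)}$, $k=1,\dots,m-1$, on the superdiagonal and zeros elsewhere, to its transpose, and to $\mathrm{diag}(m-1,m-3,\dots,1-m)$. For a partition $\pi=(n_1\ge\dots\ge n_s>0)$ of $n$ let $j_\pi=\mathrm{diag}(j_{n_1},\dots,j_{n_s})$;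 its image is called the standard $\mathfrak{sl}(2,\mathbb C)$ of type $\pi$. It is called even if $n_1,\dots,n_s$ all have the same parity. Put $E^\pi=\mathrm{diag}(e_{n_1},\dots,e_{n_s})$ and, if $\pi\ne(1,\dots,1)$, $$C_\pi=\frac{|[E^\pi,(E^\pi)^*]|^2}{|E^\pi|^4}=\frac{12}{\sum_{p=1}^s n_p(n_p^2-1)}.$$ **Theorem.** Let $A\in \mathfrak{sl}(n,\mathbb C)$ be not a scalar matrix, and suppose that $A$ is not $SL(n,\mathbb C)$-conjugate to an element of $W\setminus Z$. Then: (1) $A$ is a critical point of the function $K$ on $\mathcal O_A\setminus Z$ if and only if $A,A^*,[A,A^*]$ generate a three-dimensional complex Lie subalgebra $\mathfrak s$ which is $SU(n)$-conjugate to a standard $\mathfrak{sl}(2,\mathbb C)$. (Being a critical point on $\mathcal O_A\setminus Z$ includes $A\notin Z$.) (2) On the standard $\mathfrak{sl}(2,\mathbb C)$ of type $\pi$, for every partition $\pi$ of $n$, the function $K$ is equal to $C_\pi$ outside $Z$. (3) If $A$ is nilpotent, then $K$ on $\mathcal O_A\setminus Z$ achieves its minimum value at $A$ if and only if $A$ is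 $SU(n)$-conjugate to an element of a standard $\mathfrak{sl}(2,\mathbb C)$. (4) If $A$ is not nilpotent, then $K$ on $\mathcal O_A\setminus Z$ achieves its minimum value at $A$ (so that in particular $A\notin Z$) if and only if $A\notin Z$ and $A$ is $SU(n)$-conjugate to an element of an even standard $\mathfrak{sl}(2,\mathbb C)$. -/

import Mathlib

open Matrix

attribute [local instance] LieRing.ofAssociativeRing

namespace NessSl2

/-- The squared norm `|A|² = tr(A A*)`. -/
noncomputable def normSq {n : ℕ} (A : Matrix (Fin n) (Fin n) ℂ) : ℝ :=
  (A * Aᴴ).trace.re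

/-- The degeneracy set `Z = {A ∈ sl(n, ℂ) : |A|⁴ - |tr(A²)|² = 0}`. -/
def Z (n : ℕ) : Set (Matrix (Fin n) (Fin n) ℂ) :=
  {A | A.trace = 0 ∧ normSq A ^ 2 - ‖(A ^ 2).trace‖ ^ 2 = 0}

/-- The set `W = {A ∈ sl(n, ℂ) : [A, A*] = 0}`. -/
def W (n : ℕ) : Set (Matrix (Fin n) (Fin n) ℂ) :=
  {A | A.trace = 0 ∧ ⁅A, Aᴴ⁆ = 0}

/-- The function `K(A) = |[A, A*]|² / (|A|⁴ - |tr(A²)|²)`; it is only used on `sl(n, ℂ)` off `Z`. -/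
noncomputable def K {n : ℕ} (A : Matrix (Fin n) (Fin n) ℂ) : ℝ :=
  normSq ⁅A, Aᴴ⁆ / (normSq A ^ 2 - ‖(A ^ 2).trace‖ ^ 2)

/-- The function `K₀(A) = |[A, A*]|² / |A|⁴`. -/
noncomputable def K₀ {n : ℕ} (A : Matrix (Fin n) (Fin n) ℂ) : ℝ :=
  normSq ⁅A, Aᴴ⁆ / normSq A ^ 2

/-- The action `Ad(g) A = g A g⁻¹` of `SL(n, ℂ)`. -/
def Ad {n : ℕ} (g : SpecialLinearGroup (Fin n) ℂ) (A : Matrix (Fin n) (Fin n) ℂ) :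
    Matrix (Fin n) (Fin n) ℂ :=
  (g : Matrix (Fin n) (Fin n) ℂ) * A * ((g⁻¹ : SpecialLinearGroup (Fin n) ℂ) :
    Matrix (Fin n) (Fin n) ℂ)

/-- The adjoint orbit `𝒪_A`. -/
def orbit {n : ℕ} (A : Matrix (Fin n) (Fin n) ℂ) : Set (Matrix (Fin n) (Fin n) ℂ) :=
  {B | ∃ g : SpecialLinearGroup (Fin n) ℂ, B = Ad g A}

/-- `A` is a critical point of `K` on `𝒪_A \ Z`: it lies in this set, and the derivative of `K` at
`A` vanishes along every curve `t ↦ Ad(g(t)) A` of the orbit, where `g` is a curve in `SL(n, ℂ)`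
with `g(0) = 1` that is differentiable at `0`.  The velocities of these curves fill up the tangent
space `{[M, A] : M ∈ sl(n, ℂ)}` of the homogeneous space `𝒪_A` at `A`. -/
def IsCriticalPoint {n : ℕ} (A : Matrix (Fin n) (Fin n) ℂ) : Prop :=
  A ∈ orbit A \ Z n ∧
    ∀ g : ℝ → SpecialLinearGroup (Fin n) ℂ, g 0 = 1 →
      (∀ i j, DifferentiableAt ℝ (fun t => (g t : Matrix (Fin n) (Fin n) ℂ) i j) 0) →
      HasDerivAt (fun t => K (Ad (g t) A)) 0 0

/-- `K` restricted to `𝒪_A \ Z` achieves its minimum value at `A`. -/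
def AttainsMin {n : ℕ} (A : Matrix (Fin n) (Fin n) ℂ) : Prop :=
  A ∈ orbit A \ Z n ∧ IsMinOn K (orbit A \ Z n) A

/-- The irreducible representation `j_m` of `sl(2, ℂ)` on binary forms of degree `m - 1`, in the
basis `√(m-1 choose k) X^(m-1-k) Y^k`, `k = 0, …, m - 1`.  It maps `e, ẽ, x` to the matrices
`e_m` (entries `√(k (m - k))`, `1 ≤ k ≤ m - 1`, above the diagonal), `ẽ_m = e_mᵀ` and
`x_m = diag(m - 1, m - 3, …, 1 - m)`.  The argument `M = M₀₁ e + M₁₀ ẽ + M₀₀ x` is trace-free. -/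
noncomputable def irrep (m : ℕ) (M : Matrix (Fin 2) (Fin 2) ℂ) : Matrix (Fin m) (Fin m) ℂ :=
  Matrix.of fun i j =>
    if (j : ℕ) = i + 1 then M 0 1 * (Real.sqrt ((j : ℝ) * ((m : ℝ) - j)) : ℂ)
    else if (i : ℕ) = j + 1 then M 1 0 * (Real.sqrt ((i : ℝ) * ((m : ℝ) - i)) : ℂ)
    else if i = j then M 0 0 * ((m : ℂ) - 1 - 2 * (i : ℂ))
    else 0

/-- The parts `n₁ ≥ n₂ ≥ ⋯ ≥ n_s > 0` of a partition of `n`. -/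
def sortedParts {n : ℕ} (π : n.Partition) : List ℕ :=
  π.parts.sort (· ≥ ·)

theorem sum_sortedParts {n : ℕ} (π : n.Partition) :
    ∑ p : Fin (sortedParts π).length, (sortedParts π).get p = n := by
  have h : (sortedParts π).sum = n := by
    rw [← Multiset.sum_coe, sortedParts, Multiset.sort_eq, π.parts_sum]
  exact (Fin.sum_univ_getElem (sortedParts π)).trans h

/-- The positions `1, …, n`, cut into consecutive blocks of sizes `n₁, …, n_s`. -/
def blockEquiv {n : ℕ} (π : n.Partition) :
    (Σ p : Fin (sortedParts π).length, Fin ((sortedParts π).get p)) ≃ Fin n :=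
  finSigmaFinEquiv.trans (finCongr (sum_sortedParts π))

/-- The representation `j_π = diag(j_{n₁}, …, j_{n_s})` of `sl(2, ℂ)`. -/
noncomputable def stdRep {n : ℕ} (π : n.Partition) (M : Matrix (Fin 2) (Fin 2) ℂ) :
    Matrix (Fin n) (Fin n) ℂ :=
  Matrix.reindex (blockEquiv π) (blockEquiv π)
    (Matrix.blockDiagonal' fun p => irrep ((sortedParts π).get p) M)

/-- The standard `sl(2, ℂ)` of type `π`: the image `j_π(sl(2, ℂ))`. -/
def stdSl2 {n : ℕ} (π : n.Partition) : Set (Matrix (Fin n) (Fin n) ℂ) :=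
  {B | ∃ M : Matrix (Fin 2) (Fin 2) ℂ, M.trace = 0 ∧ B = stdRep π M}

/-- The nilpotent element `E^π = j_π(e) = diag(e_{n₁}, …, e_{n_s})`. -/
noncomputable def stdE {n : ℕ} (π : n.Partition) : Matrix (Fin n) (Fin n) ℂ :=
  stdRep π !![0, 1; 0, 0]

/-- The constant `C_π = K₀(E^π)`. -/
noncomputable def typeConst {n : ℕ} (π : n.Partition) : ℝ :=
  K₀ (stdE π)

/-- A partition is even if all its (positive) parts have the same parity. -/
def IsEvenType {n : ℕ} (π : n.Partition) : Prop :=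
  ∀ a ∈ π.parts, ∀ b ∈ π.parts, (Even a ↔ Even b)

/-- `A` is `SU(n)`-conjugate to an element of the set `S`. -/
def SUConjInto {n : ℕ} (A : Matrix (Fin n) (Fin n) ℂ) (S : Set (Matrix (Fin n) (Fin n) ℂ)) :
    Prop :=
  ∃ U ∈ specialUnitaryGroup (Fin n) ℂ, ∃ B ∈ S, A = U * B * Uᴴ

/-- The complex Lie subalgebra generated by `A, A*, [A, A*]`. -/
def genAlg {n : ℕ} (A : Matrix (Fin n) (Fin n) ℂ) :
    LieSubalgebra ℂ (Matrix (Fin n) (Fin n) ℂ) :=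
  LieSubalgebra.lieSpan ℂ (Matrix (Fin n) (Fin n) ℂ) {A, Aᴴ, ⁅A, Aᴴ⁆}

/-- The Lie subalgebra `𝔰` is `SU(n)`-conjugate to a standard `sl(2, ℂ)`. -/
def IsSUConjToStd {n : ℕ} (𝔰 : LieSubalgebra ℂ (Matrix (Fin n) (Fin n) ℂ)) : Prop :=
  ∃ U ∈ specialUnitaryGroup (Fin n) ℂ, ∃ π : n.Partition,
    (𝔰 : Set (Matrix (Fin n) (Fin n) ℂ)) = (fun B => U * B * Uᴴ) '' stdSl2 π

end NessSl2

/-!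
The function `K` is invariant under scaling and under unitary conjugation. Its gradient along the
orbit of `A` vanishes if and only if `[[A, A*], A] = l (A - s A*)`, where `s A*` is the orthogonal
projection of `A` to the line of `A*`. Writing `r ^ 2 = 1 - |s| ^ 2`, this makes
`(1 + r) A - s A*` an eigenvector of `ad [A, A*]`, and a multiple `E` of it satisfies
`[[E, E*], E] = 2 E`. As the lowering operator of this representation of `sl(2)` is the adjoint of
`E`, the space `ℂ ^ n` is an orthogonal sum of strings, so that `E` is unitarily conjugate to
some `E ^ π`. On the span of `[E, E*]`, `E` and `E*`, the function `K` is equal to `2 / |E| ^ 2`.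

For the minima, let `h` be the diagonal of `[E ^ π, (E ^ π)*]`, and grade matrices by giving the
matrix unit at `(i, j)` the degree `h i - h j`. By the Iwasawa decomposition, an element of the
orbit of `X` is unitarily conjugate to `T X T⁻¹` with `T` of degree at least zero.
* A nilpotent element of the standard `sl(2)` has `X = E ^ π` in its orbit, and `C = T X T⁻¹` has
  degree at least two. The inner product of `[C, C*]` and `diag h` is then at least `2 |C| ^ 2`, and
  the Cauchy-Schwarz inequality bounds `K`.
* Any other element of the standard `sl(2)` has a multiple of `X = diag h` in its orbit. If `π` is
  even, then distinct weights differ by at least two, and `T X T⁻¹ = X + N` with `N` of degree at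
  least two. The bound on `K` is Bessel's inequality for `[X + N, (X + N)*]` and the orthogonal
  matrices `X` and `N + N*`. If `π` is not even, then two weights differ by one, and the sum of `X`
  and a small multiple of the corresponding matrix unit lies in the orbit of `X` and has a smaller
  value of `K`.
-/

namespace NessSl2

/-! ### Traces and the Frobenius norm -/

section Algebra

variable {ι R : Type*} [Fintype ι]

theorem conjTranspose_lie [Ring R] [StarRing R] (A B : Matrix ι ι R) : ⁅A, B⁆ᴴ = ⁅Bᴴ, Aᴴ⁆ := by
  simp only [Ring.lie_def, conjTranspose_sub, conjTranspose_mul]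

theorem conjTranspose_lie_conjTranspose_self [Ring R] [StarRing R] (A : Matrix ι ι R) :
    ⁅A, Aᴴ⁆ᴴ = ⁅A, Aᴴ⁆ := by
  rw [conjTranspose_lie, conjTranspose_conjTranspose]

theorem trace_lie_mul [CommRing R] (A B C : Matrix ι ι R) :
    (⁅A, B⁆ * C).trace = (A * ⁅B, C⁆).trace := by
  rw [Ring.lie_def, Ring.lie_def, Matrix.sub_mul, Matrix.mul_sub, trace_sub, trace_sub,
    ← Matrix.mul_assoc, ← Matrix.mul_assoc, trace_mul_comm (A * C) B, Matrix.mul_assoc B A C]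

theorem trace_lie_mul_right_self [CommRing R] (A B : Matrix ι ι R) : (⁅A, B⁆ * B).trace = 0 := by
  classical rw [trace_lie_mul, lie_self, Matrix.mul_zero, trace_zero]

theorem trace_lie_mul_left_self [CommRing R] (A B : Matrix ι ι R) : (⁅A, B⁆ * A).trace = 0 := by
  classical rw [trace_mul_comm, ← trace_lie_mul, lie_self, Matrix.zero_mul, trace_zero]

theorem star_trace_mul_conjTranspose [CommRing R] [StarRing R] (A B : Matrix ι ι R) :
    star (A * Bᴴ).trace = (B * Aᴴ).trace := by
  rw [← trace_conjTranspose, conjTranspose_mul, conjTranspose_conjTranspose]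

end Algebra

section FrobeniusNorm

variable {n : ℕ}

theorem ofReal_normSq (A : Matrix (Fin n) (Fin n) ℂ) : (normSq A : ℂ) = (A * Aᴴ).trace :=
  Complex.conj_eq_iff_re.mp (star_trace_mul_conjTranspose A A)

theorem normSq_eq_sum (A : Matrix (Fin n) (Fin n) ℂ) : normSq A = ∑ i, ∑ j, ‖A i j‖ ^ 2 := by
  simp only [normSq, trace, diag_apply, mul_apply, conjTranspose_apply, Complex.re_sum,
    RCLike.star_def, Complex.mul_conj, Complex.normSq_eq_norm_sq, Complex.ofReal_re]

theorem normSq_nonneg (A : Matrix (Fin n) (Fin n) ℂ) : 0 ≤ normSq A := by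
  rw [normSq_eq_sum]
  positivity

open scoped ComplexOrder in
theorem normSq_eq_zero {A : Matrix (Fin n) (Fin n) ℂ} : normSq A = 0 ↔ A = 0 := by
  rw [← trace_mul_conjTranspose_self_eq_zero_iff, ← ofReal_normSq, Complex.ofReal_eq_zero]

theorem normSq_pos {A : Matrix (Fin n) (Fin n) ℂ} : 0 < normSq A ↔ A ≠ 0 := by
  rw [(normSq_nonneg A).lt_iff_ne, ne_comm, Ne, normSq_eq_zero]

theorem normSq_conjTranspose (A : Matrix (Fin n) (Fin n) ℂ) : normSq Aᴴ = normSq A := by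
  rw [normSq, normSq, conjTranspose_conjTranspose, trace_mul_comm]

theorem normSq_smul (c : ℂ) (A : Matrix (Fin n) (Fin n) ℂ) :
    normSq (c • A) = ‖c‖ ^ 2 * normSq A := by
  simp only [normSq_eq_sum, Finset.mul_sum, Matrix.smul_apply, smul_eq_mul, norm_mul, mul_pow]

theorem re_trace_mul_conjTranspose_comm (A B : Matrix (Fin n) (Fin n) ℂ) :
    (A * Bᴴ).trace.re = (B * Aᴴ).trace.re := by
  rw [← star_trace_mul_conjTranspose, RCLike.star_def, Complex.conj_re]

theorem normSq_add (A B : Matrix (Fin n) (Fin n) ℂ) :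
    normSq (A + B) = normSq A + normSq B + 2 * (A * Bᴴ).trace.re := by
  simp only [normSq, conjTranspose_add, Matrix.add_mul, Matrix.mul_add, trace_add, Complex.add_re,
    re_trace_mul_conjTranspose_comm B A]
  ring

theorem normSq_sub_smul (A B : Matrix (Fin n) (Fin n) ℂ) (c : ℂ) :
    normSq (A - c • B) =
      normSq A + ‖c‖ ^ 2 * normSq B - 2 * (star c * (A * Bᴴ).trace).re := by
  rw [sub_eq_add_neg, ← neg_smul, normSq_add, normSq_smul, norm_neg, conjTranspose_smul,
    Matrix.mul_smul, trace_smul, smul_eq_mul, star_neg, neg_mul, Complex.neg_re]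
  ring

/-- The Gram determinant of `A` and `A*` for the Frobenius inner product, that is, the denominator
of `K`. -/
noncomputable def gramDet (A : Matrix (Fin n) (Fin n) ℂ) : ℝ :=
  normSq A ^ 2 - ‖(A ^ 2).trace‖ ^ 2

/-- The coefficient `s` for which `s A*` is the orthogonal projection of `A` to the line of `A*`
(equal to `0` if `A = 0`). -/
noncomputable def adjointCoeff (A : Matrix (Fin n) (Fin n) ℂ) : ℂ :=
  (A ^ 2).trace / normSq A

theorem adjointCoeff_mul_normSq (A : Matrix (Fin n) (Fin n) ℂ) :
    adjointCoeff A * normSq A = (A ^ 2).trace := by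
  by_cases hA : A = 0
  · simp [hA, normSq]
  · exact div_mul_cancel₀ _ (Complex.ofReal_ne_zero.mpr (normSq_pos.mpr hA).ne')

theorem gramDet_eq_mul_one_sub (A : Matrix (Fin n) (Fin n) ℂ) :
    gramDet A = normSq A ^ 2 * (1 - ‖adjointCoeff A‖ ^ 2) := by
  rw [gramDet, ← adjointCoeff_mul_normSq, norm_mul, mul_pow, Complex.norm_real, Real.norm_eq_abs,
    sq_abs]
  ring

theorem normSq_sub_adjointCoeff_smul (A : Matrix (Fin n) (Fin n) ℂ) :
    normSq (A - adjointCoeff A • Aᴴ) = normSq A * (1 - ‖adjointCoeff A‖ ^ 2) := by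
  have h : (star (adjointCoeff A) * (A * A).trace).re = ‖adjointCoeff A‖ ^ 2 * normSq A := by
    rw [← sq A, ← adjointCoeff_mul_normSq, ← mul_assoc, RCLike.star_def, Complex.conj_mul',
      ← Complex.ofReal_pow, ← Complex.ofReal_mul, Complex.ofReal_re]
  rw [normSq_sub_smul, conjTranspose_conjTranspose, h, normSq_conjTranspose]
  ring

theorem normSq_mul_normSq_sub_adjointCoeff_smul (A : Matrix (Fin n) (Fin n) ℂ) :
    normSq A * normSq (A - adjointCoeff A • Aᴴ) = gramDet A := by
  rw [normSq_sub_adjointCoeff_smul, gramDet_eq_mul_one_sub]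
  ring

theorem gramDet_nonneg (A : Matrix (Fin n) (Fin n) ℂ) : 0 ≤ gramDet A := by
  rw [← normSq_mul_normSq_sub_adjointCoeff_smul]
  exact mul_nonneg (normSq_nonneg _) (normSq_nonneg _)

theorem gramDet_le_normSq_sq (A : Matrix (Fin n) (Fin n) ℂ) : gramDet A ≤ normSq A ^ 2 :=
  sub_le_self _ (sq_nonneg _)

theorem ne_zero_of_gramDet_pos {A : Matrix (Fin n) (Fin n) ℂ} (hA : 0 < gramDet A) : A ≠ 0 := by
  rintro rfl
  simp [gramDet, normSq] at hA

theorem norm_adjointCoeff_lt_one {A : Matrix (Fin n) (Fin n) ℂ} (hA : 0 < gramDet A) :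
    ‖adjointCoeff A‖ < 1 := by
  rw [gramDet_eq_mul_one_sub] at hA
  have h : 0 < 1 - ‖adjointCoeff A‖ ^ 2 := pos_of_mul_pos_right hA (sq_nonneg _)
  nlinarith [norm_nonneg (adjointCoeff A)]

theorem notMem_Z_iff {A : Matrix (Fin n) (Fin n) ℂ} (hA : A.trace = 0) :
    A ∉ Z n ↔ 0 < gramDet A := by
  rw [(gramDet_nonneg A).lt_iff_ne, ne_comm]
  simp [Z, gramDet, hA]

theorem K_eq_div_gramDet (A : Matrix (Fin n) (Fin n) ℂ) : K A = normSq ⁅A, Aᴴ⁆ / gramDet A := rfl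

theorem gramDet_smul (c : ℂ) (A : Matrix (Fin n) (Fin n) ℂ) :
    gramDet (c • A) = ‖c‖ ^ 4 * gramDet A := by
  rw [gramDet, gramDet, normSq_smul, smul_pow, trace_smul, smul_eq_mul, norm_mul, norm_pow]
  ring

theorem gramDet_smul_pos {c : ℂ} (hc : c ≠ 0) {A : Matrix (Fin n) (Fin n) ℂ}
    (hA : 0 < gramDet A) : 0 < gramDet (c • A) := by
  rw [gramDet_smul]
  exact mul_pos (pow_pos (norm_pos_iff.mpr hc) 4) hA

theorem K_smul {c : ℂ} (hc : c ≠ 0) (A : Matrix (Fin n) (Fin n) ℂ) : K (c • A) = K A := by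
  have h : normSq ⁅c • A, (c • A)ᴴ⁆ = ‖c‖ ^ 4 * normSq ⁅A, Aᴴ⁆ := by
    rw [conjTranspose_smul, smul_lie, lie_smul, normSq_smul, normSq_smul, norm_star]
    ring
  rw [K_eq_div_gramDet, K_eq_div_gramDet, gramDet_smul, h,
    mul_div_mul_left _ _ (pow_ne_zero 4 (norm_ne_zero_iff.mpr hc))]

end FrobeniusNorm

/-! ### The copy of `sl(2)` spanned by `[E, E*]`, `E` and `E*` -/

section Raising

variable {ι R : Type*} [Fintype ι] [CommRing R] [StarRing R]

/-- `E` is the raising operator of a unitary representation of `sl(2)`: the matrices `[E, E*]`, `E`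
and `E*` satisfy the relations of the standard basis of `sl(2)`. In contrast to `IsSl2Triple`,
the trivial representation `E = 0` is allowed. -/
def IsRaising (E : Matrix ι ι R) : Prop :=
  ⁅⁅E, Eᴴ⁆, E⁆ = (2 : R) • E

/-- The element with coordinates `a, b, c` in the basis `[E, E*], E, E*` of the copy of `sl(2)` that
belongs to a raising operator `E`. -/
def sl2Comb (E : Matrix ι ι R) (a b c : R) : Matrix ι ι R :=
  a • ⁅E, Eᴴ⁆ + b • E + c • Eᴴ

theorem conjTranspose_sl2Comb (E : Matrix ι ι R) (a b c : R) :
    (sl2Comb E a b c)ᴴ = sl2Comb E (star a) (star c) (star b) := by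
  simp only [sl2Comb, conjTranspose_add, conjTranspose_smul, conjTranspose_conjTranspose,
    conjTranspose_lie_conjTranspose_self]
  abel

theorem sl2Comb_conjTranspose (E : Matrix ι ι R) (a b c : R) :
    sl2Comb Eᴴ a b c = sl2Comb E (-a) c b := by
  classical
  simp only [sl2Comb, conjTranspose_conjTranspose, ← lie_skew E Eᴴ, smul_neg, neg_smul, neg_neg]
  abel

namespace IsRaising

variable {E : Matrix ι ι R}

theorem lie_lie_conjTranspose (hE : IsRaising E) : ⁅⁅E, Eᴴ⁆, Eᴴ⁆ = -((2 : R) • Eᴴ) := by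
  classical
  have h := congrArg conjTranspose hE
  rw [conjTranspose_lie, conjTranspose_lie_conjTranspose_self, ← lie_skew, conjTranspose_smul,
    star_ofNat] at h
  exact neg_eq_iff_eq_neg.mp h

theorem conjTranspose (hE : IsRaising E) : IsRaising Eᴴ := by
  classical
  rw [IsRaising, conjTranspose_conjTranspose, ← lie_skew Eᴴ E, neg_lie, hE.lie_lie_conjTranspose,
    neg_neg]

theorem lie_sl2Comb (hE : IsRaising E) (a b c x y z : R) :
    ⁅sl2Comb E a b c, sl2Comb E x y z⁆ =
      sl2Comb E (b * z - c * y) (2 * (a * y - b * x)) (2 * (c * x - a * z)) := by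
  classical
  have hEH : ⁅E, ⁅E, Eᴴ⁆⁆ = -((2 : R) • E) := by rw [← lie_skew, hE]
  have hFH : ⁅Eᴴ, ⁅E, Eᴴ⁆⁆ = (2 : R) • Eᴴ := by
    rw [← lie_skew, hE.lie_lie_conjTranspose, neg_neg]
  have hFE : ⁅Eᴴ, E⁆ = -⁅E, Eᴴ⁆ := (lie_skew _ _).symm
  have hHE : ⁅⁅E, Eᴴ⁆, E⁆ = (2 : R) • E := hE
  simp only [sl2Comb, lie_add, add_lie, lie_smul, smul_lie, lie_self, hHE,
    hE.lie_lie_conjTranspose, hEH, hFH, hFE]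
  module

section Trace

variable [NoZeroDivisors R] [CharZero R]

theorem trace_eq_zero (hE : IsRaising E) : E.trace = 0 := by
  have h := congrArg trace hE
  rw [LieAlgebra.matrix_trace_commutator_zero, trace_smul, smul_eq_mul, zero_eq_mul] at h
  exact h.resolve_left two_ne_zero

theorem trace_sl2Comb (hE : IsRaising E) (a b c : R) : (sl2Comb E a b c).trace = 0 := by
  simp only [sl2Comb, trace_add, trace_smul, LieAlgebra.matrix_trace_commutator_zero,
    hE.trace_eq_zero, hE.conjTranspose.trace_eq_zero, smul_zero, add_zero]

theorem trace_mul_self (hE : IsRaising E) : (E * E).trace = 0 := by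
  classical
  have h := trace_lie_mul ⁅E, Eᴴ⁆ E E
  rw [hE, lie_self, Matrix.mul_zero, trace_zero, Matrix.smul_mul, trace_smul, smul_eq_mul,
    mul_eq_zero] at h
  exact h.resolve_left two_ne_zero

theorem trace_lie_mul_self (hE : IsRaising E) : (⁅E, Eᴴ⁆ * E).trace = 0 := by
  classical
  have h := trace_lie_mul ⁅E, Eᴴ⁆ ⁅E, Eᴴ⁆ E
  rw [hE, lie_self, Matrix.zero_mul, trace_zero, Matrix.mul_smul, trace_smul, smul_eq_mul,
    zero_eq_mul] at h
  exact h.resolve_left two_ne_zero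

theorem trace_lie_mul_conjTranspose (hE : IsRaising E) : (⁅E, Eᴴ⁆ * Eᴴ).trace = 0 := by
  classical
  have h := hE.conjTranspose.trace_lie_mul_self
  rwa [conjTranspose_conjTranspose, ← lie_skew, Matrix.neg_mul, trace_neg, neg_eq_zero] at h

theorem trace_sl2Comb_mul_sl2Comb (hE : IsRaising E) (a b c x y z : R) :
    (sl2Comb E a b c * sl2Comb E x y z).trace = (E * Eᴴ).trace * (2 * a * x + b * z + c * y) := by
  classical
  have hHH : (⁅E, Eᴴ⁆ * ⁅E, Eᴴ⁆).trace = 2 * (E * Eᴴ).trace := by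
    rw [trace_lie_mul, ← lie_skew, hE.lie_lie_conjTranspose, neg_neg, Matrix.mul_smul, trace_smul,
      smul_eq_mul]
  have hFF : (Eᴴ * Eᴴ).trace = 0 := hE.conjTranspose.trace_mul_self
  simp only [sl2Comb, Matrix.add_mul, Matrix.mul_add, Matrix.smul_mul, Matrix.mul_smul, trace_add,
    trace_smul, smul_eq_mul, hHH, hE.trace_mul_self, hFF, hE.trace_lie_mul_self,
    hE.trace_lie_mul_conjTranspose, trace_mul_comm E ⁅E, Eᴴ⁆, trace_mul_comm Eᴴ ⁅E, Eᴴ⁆,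
    trace_mul_comm Eᴴ E]
  ring

end Trace

variable [DecidableEq ι]

/-- The copy of `sl(2)` spanned by `[E, E*], E, E*`. -/
def toLieSubalgebra (hE : IsRaising E) : LieSubalgebra R (Matrix ι ι R) where
  carrier := {B | ∃ a b c, sl2Comb E a b c = B}
  zero_mem' := ⟨0, 0, 0, by simp [sl2Comb]⟩
  add_mem' := by
    rintro _ _ ⟨a, b, c, rfl⟩ ⟨x, y, z, rfl⟩
    exact ⟨a + x, b + y, c + z, by simp only [sl2Comb]; module⟩
  smul_mem' := by
    rintro r _ ⟨a, b, c, rfl⟩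
    exact ⟨r * a, r * b, r * c, by simp only [sl2Comb]; module⟩
  lie_mem' := by
    rintro _ _ ⟨a, b, c, rfl⟩ ⟨x, y, z, rfl⟩
    exact ⟨_, _, _, (hE.lie_sl2Comb a b c x y z).symm⟩

theorem conjTranspose_mem_toLieSubalgebra (hE : IsRaising E) {B : Matrix ι ι R}
    (hB : B ∈ hE.toLieSubalgebra) : Bᴴ ∈ hE.toLieSubalgebra := by
  obtain ⟨a, b, c, rfl⟩ := hB
  exact ⟨_, _, _, (conjTranspose_sl2Comb E a b c).symm⟩

theorem toLieSubalgebra_le (hE : IsRaising E) {L : LieSubalgebra R (Matrix ι ι R)} (h : E ∈ L)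
    (h' : Eᴴ ∈ L) : hE.toLieSubalgebra ≤ L := by
  rintro _ ⟨a, b, c, rfl⟩
  exact L.add_mem (L.add_mem (L.smul_mem a (L.lie_mem h h')) (L.smul_mem b h)) (L.smul_mem c h')

end IsRaising

end Raising

section RaisingComplex

variable {n : ℕ} {E : Matrix (Fin n) (Fin n) ℂ}

namespace IsRaising

theorem normSq_sl2Comb (hE : IsRaising E) (a b c : ℂ) :
    normSq (sl2Comb E a b c) = normSq E * (2 * ‖a‖ ^ 2 + ‖b‖ ^ 2 + ‖c‖ ^ 2) := by
  apply Complex.ofReal_injective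
  rw [ofReal_normSq, conjTranspose_sl2Comb, hE.trace_sl2Comb_mul_sl2Comb, ← ofReal_normSq]
  simp only [RCLike.star_def, Complex.mul_conj', mul_assoc]
  push_cast
  rfl

theorem normSq_lie_conjTranspose (hE : IsRaising E) : normSq ⁅E, Eᴴ⁆ = 2 * normSq E := by
  have h := hE.normSq_sl2Comb 1 0 0
  simp only [sl2Comb, one_smul, zero_smul, add_zero, norm_one, norm_zero] at h
  linarith

theorem trace_sl2Comb_sq (hE : IsRaising E) (a b c : ℂ) :
    (sl2Comb E a b c ^ 2).trace = normSq E * (2 * (a ^ 2 + b * c)) := by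
  rw [sq, hE.trace_sl2Comb_mul_sl2Comb, ofReal_normSq]
  ring

theorem sl2Comb_eq_zero_iff (hE : IsRaising E) (hE0 : E ≠ 0) {a b c : ℂ} :
    sl2Comb E a b c = 0 ↔ a = 0 ∧ b = 0 ∧ c = 0 := by
  rw [← normSq_eq_zero, hE.normSq_sl2Comb, mul_eq_zero, or_iff_right (normSq_pos.mpr hE0).ne']
  constructor
  · intro h
    have := sq_nonneg ‖a‖
    have := sq_nonneg ‖b‖
    have := sq_nonneg ‖c‖
    refine ⟨?_, ?_, ?_⟩ <;> rw [← norm_eq_zero, ← sq_eq_zero_iff] <;> linarith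
  · rintro ⟨rfl, rfl, rfl⟩
    simp

theorem finrank_toLieSubalgebra (hE : IsRaising E) (hE0 : E ≠ 0) :
    Module.finrank ℂ hE.toLieSubalgebra = 3 := by
  have hli : LinearIndependent ℂ ![⁅E, Eᴴ⁆, E, Eᴴ] := by
    rw [Fintype.linearIndependent_iff]
    intro g hg
    rw [Fin.sum_univ_three] at hg
    obtain ⟨h0, h1, h2⟩ := (hE.sl2Comb_eq_zero_iff hE0).mp hg
    intro i
    fin_cases i <;> assumption
  have hspan : hE.toLieSubalgebra.toSubmodule =
      Submodule.span ℂ (Set.range ![⁅E, Eᴴ⁆, E, Eᴴ]) := by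
    ext B
    rw [Submodule.mem_span_range_iff_exists_fun]
    constructor
    · rintro ⟨a, b, c, rfl⟩
      exact ⟨![a, b, c], by simp [Fin.sum_univ_three, sl2Comb]⟩
    · rintro ⟨g, rfl⟩
      exact ⟨g 0, g 1, g 2, by simp [Fin.sum_univ_three, sl2Comb]⟩
  have h := finrank_span_eq_card hli
  rwa [← hspan, Fintype.card_fin] at h

theorem gramDet_sl2Comb (hE : IsRaising E) (a b c : ℂ) :
    gramDet (sl2Comb E a b c) =
      normSq E ^ 2 * ((2 * ‖a‖ ^ 2 + ‖b‖ ^ 2 + ‖c‖ ^ 2) ^ 2 - 4 * ‖a ^ 2 + b * c‖ ^ 2) := by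
  rw [gramDet, hE.normSq_sl2Comb, hE.trace_sl2Comb_sq, norm_mul, norm_mul, Complex.norm_real,
    Complex.norm_ofNat, mul_pow, mul_pow, Real.norm_eq_abs, sq_abs]
  ring

theorem lie_sl2Comb_conjTranspose (hE : IsRaising E) (a b c : ℂ) :
    ⁅sl2Comb E a b c, (sl2Comb E a b c)ᴴ⁆ = sl2Comb E (b * star b - c * star c)
      (2 * (a * star c - b * star a)) (2 * (c * star a - a * star b)) := by
  rw [conjTranspose_sl2Comb, hE.lie_sl2Comb]

theorem normSq_mul_normSq_lie_sl2Comb (hE : IsRaising E) (a b c : ℂ) :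
    normSq E * normSq ⁅sl2Comb E a b c, (sl2Comb E a b c)ᴴ⁆ = 2 * gramDet (sl2Comb E a b c) := by
  rw [hE.lie_sl2Comb_conjTranspose, hE.gramDet_sl2Comb, hE.normSq_sl2Comb]
  simp only [norm_mul, mul_pow, ← Complex.normSq_eq_norm_sq, Complex.normSq_apply]
  simp only [RCLike.star_def, Complex.sub_re, Complex.mul_re, Complex.conj_re, Complex.conj_im,
    mul_neg, sub_neg_eq_add, Complex.sub_im, Complex.mul_im, Complex.re_ofNat, Complex.im_ofNat,
    mul_zero, add_zero, pow_two, Complex.add_re, Complex.add_im]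
  ring

theorem normSq_pos_of_gramDet_pos (hE : IsRaising E) {a b c : ℂ}
    (hD : 0 < gramDet (sl2Comb E a b c)) : 0 < normSq E := by
  rw [hE.gramDet_sl2Comb] at hD
  exact (normSq_nonneg E).lt_of_ne fun h0 => by simp [← h0] at hD

theorem K_sl2Comb (hE : IsRaising E) {a b c : ℂ} (hD : 0 < gramDet (sl2Comb E a b c)) :
    K (sl2Comb E a b c) = 2 / normSq E := by
  rw [K_eq_div_gramDet, div_eq_div_iff hD.ne' (hE.normSq_pos_of_gramDet_pos hD).ne', mul_comm,
    hE.normSq_mul_normSq_lie_sl2Comb]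

theorem K₀_eq (hE : IsRaising E) (hE0 : 0 < normSq E) : K₀ E = 2 / normSq E := by
  rw [K₀, hE.normSq_lie_conjTranspose]
  field_simp

end IsRaising

end RaisingComplex

/-! ### The critical point equation -/

section Raising

variable {ι : Type*} [Fintype ι]

theorem isRaising_sqrt_smul {E : Matrix ι ι ℂ} {k : ℝ} (hk : 0 < k)
    (hE : ⁅⁅E, Eᴴ⁆, E⁆ = (k : ℂ) • E) : IsRaising ((√(2 / k) : ℂ) • E) := by
  classical
  have hsq : (√(2 / k) * √(2 / k) * k : ℂ) = 2 := by
    norm_cast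
    rw [Real.mul_self_sqrt (by positivity), div_mul_cancel₀ _ hk.ne']
  rw [IsRaising, conjTranspose_smul, RCLike.star_def, Complex.conj_ofReal]
  simp only [smul_lie, lie_smul, hE, smul_smul]
  rw [← hsq]
  ring_nf

/-- Write `|s|² = 1 - r²`. The eigenvectors of `ad [A, A*]` on the span of `A` and `A*` are
`(1 + r) A - s A*` and its adjoint. -/
theorem exists_lie_lie_eq_smul {A : Matrix ι ι ℂ} {l : ℝ} {s : ℂ} (hl : 0 < l)
    (hs : ‖s‖ < 1) (h : ⁅⁅A, Aᴴ⁆, A⁆ = (l : ℂ) • (A - s • Aᴴ)) :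
    ∃ (E : Matrix ι ι ℂ) (k : ℝ), 0 < k ∧ ⁅⁅E, Eᴴ⁆, E⁆ = (k : ℂ) • E ∧
      (∃ x y : ℂ, x • A + y • Aᴴ = E) ∧ ∃ b c : ℂ, b • E + c • Eᴴ = A := by
  classical
  have hs' : 0 < 1 - ‖s‖ ^ 2 := by nlinarith [norm_nonneg s]
  obtain ⟨r, hr, hr2⟩ : ∃ r : ℝ, 0 < r ∧ r ^ 2 = 1 - ‖s‖ ^ 2 :=
    ⟨√(1 - ‖s‖ ^ 2), Real.sqrt_pos.mpr hs', Real.sq_sqrt hs'.le⟩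
  have hss : s * star s = 1 - (r : ℂ) ^ 2 := by
    rw [RCLike.star_def, Complex.mul_conj', ← Complex.ofReal_pow r, hr2]
    push_cast
    ring
  have h' : ⁅⁅A, Aᴴ⁆, Aᴴ⁆ = -((l : ℂ) • (Aᴴ - star s • A)) := by
    have := congrArg conjTranspose h
    rw [conjTranspose_lie, conjTranspose_lie_conjTranspose_self, ← lie_skew,
      neg_eq_iff_eq_neg] at this
    rw [this, conjTranspose_smul, conjTranspose_sub, conjTranspose_smul,
      conjTranspose_conjTranspose, Complex.star_def, Complex.conj_ofReal]
  set E : Matrix ι ι ℂ := (1 + r : ℂ) • A - s • Aᴴ with hE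
  have hE' : Eᴴ = (1 + r : ℂ) • Aᴴ - star s • A := by simp [hE]
  have hHE : ⁅⁅A, Aᴴ⁆, E⁆ = (l * r : ℂ) • E := by
    rw [hE, lie_sub, lie_smul, lie_smul, h, h']
    linear_combination (norm := module) (-l * hss) • A
  have hAA : ⁅Aᴴ, A⁆ = -⁅A, Aᴴ⁆ := (lie_skew _ _).symm
  have hH : ⁅E, Eᴴ⁆ = (2 * r * (1 + r) : ℂ) • ⁅A, Aᴴ⁆ := by
    rw [hE', hE]
    simp only [lie_sub, sub_lie, lie_smul, smul_lie, lie_self, hAA]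
    linear_combination (norm := module) (-hss) • ⁅A, Aᴴ⁆
  have hA : (1 + r : ℂ) • E + s • Eᴴ = (2 * r * (1 + r) : ℂ) • A := by
    rw [hE', hE]
    linear_combination (norm := module) (-hss) • A
  have hr0 : (2 * r * (1 + r) : ℂ) ≠ 0 := by
    exact_mod_cast (by positivity : 2 * r * (1 + r) ≠ 0)
  refine ⟨E, 2 * r * (1 + r) * (l * r), by positivity, ?_, ⟨1 + r, -s, by rw [hE]; module⟩,
    (2 * r * (1 + r) : ℂ)⁻¹ * (1 + r), (2 * r * (1 + r) : ℂ)⁻¹ * s, ?_⟩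
  · rw [hH, smul_lie, hHE, smul_smul]
    push_cast
    rfl
  · rw [mul_smul, mul_smul, ← smul_add, hA, inv_smul_smul₀ hr0]

theorem exists_isRaising_of_lie_lie_eq {A : Matrix ι ι ℂ} {l : ℝ} {s : ℂ} (hl : 0 < l)
    (hs : ‖s‖ < 1) (h : ⁅⁅A, Aᴴ⁆, A⁆ = (l : ℂ) • (A - s • Aᴴ)) :
    ∃ E, IsRaising E ∧ (∃ x y : ℂ, x • A + y • Aᴴ = E) ∧ ∃ b c, sl2Comb E 0 b c = A := by
  obtain ⟨E, k, hk, hE, ⟨x, y, rfl⟩, b, c, hA⟩ := exists_lie_lie_eq_smul hl hs h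
  set w : ℂ := ((√(2 / k) : ℝ) : ℂ)
  have hw : w ≠ 0 := Complex.ofReal_ne_zero.mpr (Real.sqrt_pos.mpr (by positivity)).ne'
  refine ⟨_, isRaising_sqrt_smul hk hE, ⟨w * x, w * y, ?_⟩, w⁻¹ * b, (star w)⁻¹ * c, ?_⟩
  · rw [smul_add, smul_smul, smul_smul]
  · rw [sl2Comb, zero_smul, zero_add, conjTranspose_smul, smul_smul, smul_smul,
      mul_right_comm, inv_mul_cancel₀ hw, one_mul, mul_right_comm,
      inv_mul_cancel₀ (star_ne_zero.mpr hw), one_mul, hA]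

end Raising

section CriticalEquation

variable {n : ℕ}

theorem genAlg_eq_toLieSubalgebra {A E : Matrix (Fin n) (Fin n) ℂ} (hE : IsRaising E)
    (hA : A ∈ hE.toLieSubalgebra) (h : E ∈ genAlg A) (h' : Eᴴ ∈ genAlg A) :
    genAlg A = hE.toLieSubalgebra := by
  refine le_antisymm ?_ (hE.toLieSubalgebra_le h h')
  rw [genAlg, LieSubalgebra.lieSpan_le]
  rintro _ (rfl | rfl | rfl)
  exacts [hA, hE.conjTranspose_mem_toLieSubalgebra hA,
    LieSubalgebra.lie_mem _ hA (hE.conjTranspose_mem_toLieSubalgebra hA)]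

/-- The gradient of `K` at `A` along the orbit of `A`, up to the positive factor
`gramDet A ^ 2 / 4`. -/
noncomputable def critGrad (A : Matrix (Fin n) (Fin n) ℂ) : Matrix (Fin n) (Fin n) ℂ :=
  (gramDet A : ℂ) • ⁅A, ⁅Aᴴ, ⁅A, Aᴴ⁆⁆⁆ - (normSq ⁅A, Aᴴ⁆ * normSq A : ℂ) • ⁅A, Aᴴ⁆

theorem conjTranspose_critGrad (A : Matrix (Fin n) (Fin n) ℂ) :
    (critGrad A)ᴴ = critGrad A := by
  have h : ⁅A, ⁅Aᴴ, ⁅A, Aᴴ⁆⁆⁆ᴴ = ⁅A, ⁅Aᴴ, ⁅A, Aᴴ⁆⁆⁆ := by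
    simp only [conjTranspose_lie, conjTranspose_conjTranspose]
    rw [lie_lie, lie_self, zero_sub, ← lie_neg, lie_skew]
  simp [critGrad, h, conjTranspose_lie_conjTranspose_self]

theorem trace_critGrad (A : Matrix (Fin n) (Fin n) ℂ) : (critGrad A).trace = 0 := by
  simp only [critGrad, trace_sub, trace_smul, LieAlgebra.matrix_trace_commutator_zero, smul_zero,
    sub_zero]

/-- This is the equality case of the Cauchy-Schwarz inequality for the left-hand side and the
component of `A` orthogonal to `A*`. -/
theorem lie_lie_eq_of_critGrad_eq_zero {A : Matrix (Fin n) (Fin n) ℂ} (hD : 0 < gramDet A)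
    (h : critGrad A = 0) :
    ⁅⁅A, Aᴴ⁆, A⁆ = ((normSq ⁅A, Aᴴ⁆ * normSq A / gramDet A : ℝ) : ℂ) •
      (A - adjointCoeff A • Aᴴ) := by
  set M := ⁅A, Aᴴ⁆ with hM
  set l := normSq M * normSq A / gramDet A with hl
  have hMs : Mᴴ = M := conjTranspose_lie_conjTranspose_self A
  have hMM : (M * M).trace = normSq M := by rw [ofReal_normSq, hMs]
  have hB : normSq ⁅M, A⁆ = l * normSq M := by
    have h1 := congrArg (fun X => (M * X).trace) h
    simp only [critGrad, ← hM, Matrix.mul_sub, Matrix.mul_smul, trace_sub, trace_smul, smul_eq_mul,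
      hMM, Matrix.mul_zero, trace_zero] at h1
    rw [← trace_lie_mul, ← hMs, ← conjTranspose_lie, hMs, ← ofReal_normSq] at h1
    norm_cast at h1
    rw [hl]
    field_simp
    linarith
  have hBA : (⁅M, A⁆ * (A - adjointCoeff A • Aᴴ)ᴴ).trace = normSq M := by
    have h2 : (⁅M, A⁆ * A).trace = 0 := trace_lie_mul_right_self M A
    have h3 : (⁅M, A⁆ * Aᴴ).trace = normSq M := by rw [trace_lie_mul, ← hM, hMM]
    simp [Matrix.mul_sub, h2, h3]
  have hA : l * normSq (A - adjointCoeff A • Aᴴ) = normSq M := by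
    rw [hl, div_mul_eq_mul_div, mul_assoc, normSq_mul_normSq_sub_adjointCoeff_smul,
      mul_div_cancel_right₀ _ hD.ne']
  rw [← sub_eq_zero, ← normSq_eq_zero, normSq_sub_smul, hB, hBA, RCLike.star_def,
    Complex.conj_ofReal, ← Complex.ofReal_mul, Complex.ofReal_re, Complex.norm_real,
    Real.norm_eq_abs, sq_abs]
  linear_combination l * hA

theorem exists_isRaising_of_critGrad_eq_zero {A : Matrix (Fin n) (Fin n) ℂ}
    (hD : 0 < gramDet A) (hM : ⁅A, Aᴴ⁆ ≠ 0) (h : critGrad A = 0) :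
    ∃ E, ∃ hE : IsRaising E, E ≠ 0 ∧ genAlg A = hE.toLieSubalgebra := by
  have hA := ne_zero_of_gramDet_pos hD
  have hl : 0 < normSq ⁅A, Aᴴ⁆ * normSq A / gramDet A :=
    div_pos (mul_pos (normSq_pos.mpr hM) (normSq_pos.mpr hA)) hD
  obtain ⟨E, hE, ⟨x, y, hxy⟩, b, c, hbc⟩ := exists_isRaising_of_lie_lie_eq hl
    (norm_adjointCoeff_lt_one hD) (lie_lie_eq_of_critGrad_eq_zero hD h)
  have hAmem : A ∈ genAlg A := LieSubalgebra.subset_lieSpan (by simp)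
  have hAmem' : Aᴴ ∈ genAlg A := LieSubalgebra.subset_lieSpan (by simp)
  refine ⟨E, hE, ?_, genAlg_eq_toLieSubalgebra hE ⟨0, b, c, hbc⟩ ?_ ?_⟩
  · rintro rfl
    exact hA (by rw [← hbc]; simp [sl2Comb])
  · rw [← hxy]
    exact add_mem ((genAlg A).smul_mem x hAmem) ((genAlg A).smul_mem y hAmem')
  · rw [← hxy, conjTranspose_add, conjTranspose_smul, conjTranspose_smul,
      conjTranspose_conjTranspose]
    exact add_mem ((genAlg A).smul_mem _ hAmem') ((genAlg A).smul_mem _ hAmem)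

namespace IsRaising

variable {E : Matrix (Fin n) (Fin n) ℂ}

theorem normSq_smul_lie_lie_lie (hE : IsRaising E) {A : Matrix (Fin n) (Fin n) ℂ}
    (hA : A ∈ hE.toLieSubalgebra) :
    (normSq E : ℂ) • ⁅A, ⁅Aᴴ, ⁅A, Aᴴ⁆⁆⁆ = (2 * normSq A : ℂ) • ⁅A, Aᴴ⁆ := by
  obtain ⟨a, b, c, rfl⟩ := hA
  rw [hE.lie_sl2Comb_conjTranspose, conjTranspose_sl2Comb, hE.lie_sl2Comb, hE.lie_sl2Comb,
    hE.normSq_sl2Comb]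
  simp only [sl2Comb]
  push_cast
  simp only [← Complex.conj_mul', RCLike.star_def]
  module

theorem critGrad_eq_zero (hE : IsRaising E) {A : Matrix (Fin n) (Fin n) ℂ}
    (hA : A ∈ hE.toLieSubalgebra) (hD : 0 < gramDet A) : critGrad A = 0 := by
  obtain ⟨a, b, c, rfl⟩ := hA
  have hE0 : (normSq E : ℂ) ≠ 0 := Complex.ofReal_ne_zero.mpr (hE.normSq_pos_of_gramDet_pos hD).ne'
  have h : (normSq E * normSq ⁅sl2Comb E a b c, (sl2Comb E a b c)ᴴ⁆ : ℂ) =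
      2 * gramDet (sl2Comb E a b c) := by
    exact_mod_cast hE.normSq_mul_normSq_lie_sl2Comb a b c
  apply (smul_right_injective _ hE0)
  simp only [critGrad]
  rw [smul_sub, smul_comm, hE.normSq_smul_lie_lie_lie ⟨a, b, c, rfl⟩, smul_smul, smul_smul,
    ← mul_assoc, ← mul_assoc, h, smul_zero]
  module

end IsRaising

end CriticalEquation

/-! ### The standard `sl(2)` -/

section Algebra

variable {ι κ R : Type*} [Fintype ι] [Fintype κ]

theorem lie_diagonal_apply [DecidableEq ι] [CommRing R] (d : ι → R) (A : Matrix ι ι R) (i j : ι) :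
    ⁅diagonal d, A⁆ i j = (d i - d j) * A i j := by
  rw [Ring.lie_def, Matrix.sub_apply, diagonal_mul, mul_diagonal]
  ring

theorem lie_submatrix_equiv [Ring R] (e : κ ≃ ι) (A B : Matrix ι ι R) :
    ⁅A.submatrix e e, B.submatrix e e⁆ = ⁅A, B⁆.submatrix e e := by
  rw [Ring.lie_def, submatrix_mul_equiv, submatrix_mul_equiv, Ring.lie_def]
  rfl

theorem IsRaising.submatrix [CommRing R] [StarRing R] {E : Matrix ι ι R} (hE : IsRaising E)
    (e : κ ≃ ι) : IsRaising (E.submatrix e e) := by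
  rw [IsRaising, conjTranspose_submatrix, lie_submatrix_equiv, lie_submatrix_equiv, hE]
  rfl

theorem sl2Comb_submatrix [CommRing R] [StarRing R] (E : Matrix ι ι R) (e : κ ≃ ι) (a b c : R) :
    sl2Comb (E.submatrix e e) a b c = (sl2Comb E a b c).submatrix e e := by
  rw [sl2Comb, conjTranspose_submatrix, lie_submatrix_equiv]
  rfl

end Algebra

section BlockDiagonal

variable {o R : Type*} {ι : o → Type*} [Fintype o] [DecidableEq o] [∀ p, Fintype (ι p)]

theorem lie_blockDiagonal' [Ring R] (A B : ∀ p, Matrix (ι p) (ι p) R) :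
    ⁅blockDiagonal' A, blockDiagonal' B⁆ = blockDiagonal' fun p => ⁅A p, B p⁆ := by
  rw [Ring.lie_def, ← blockDiagonal'_mul, ← blockDiagonal'_mul, ← blockDiagonal'_sub]
  rfl

variable [CommRing R] [StarRing R]

theorem isRaising_blockDiagonal' {E : ∀ p, Matrix (ι p) (ι p) R} (hE : ∀ p, IsRaising (E p)) :
    IsRaising (blockDiagonal' E) := by
  rw [IsRaising, blockDiagonal'_conjTranspose, lie_blockDiagonal', lie_blockDiagonal',
    ← blockDiagonal'_smul]
  exact congrArg _ (funext hE)

theorem sl2Comb_blockDiagonal' (E : ∀ p, Matrix (ι p) (ι p) R) (a b c : R) :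
    sl2Comb (blockDiagonal' E) a b c = blockDiagonal' fun p => sl2Comb (E p) a b c := by
  rw [sl2Comb, blockDiagonal'_conjTranspose, lie_blockDiagonal', ← blockDiagonal'_smul,
    ← blockDiagonal'_smul, ← blockDiagonal'_smul, ← blockDiagonal'_add, ← blockDiagonal'_add]
  rfl

end BlockDiagonal

section Superdiagonal

/-- The matrix with entries `c 1, c 2, …` above the diagonal, and zeros elsewhere. -/
def superdiagonal {R : Type*} [Zero R] (m : ℕ) (c : ℕ → R) : Matrix (Fin m) (Fin m) R :=
  of fun i j => if (j : ℕ) = i + 1 then c j else 0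

variable {R : Type*} [NonUnitalSemiring R] [StarRing R] {m : ℕ} {c : ℕ → R}

theorem superdiagonal_mul_conjTranspose (hc : c m = 0) :
    superdiagonal m c * (superdiagonal m c)ᴴ =
      diagonal fun i : Fin m => c (i + 1) * star (c (i + 1)) := by
  ext i j
  have hi : m ≤ i + 1 → c (i + 1) = 0 := fun h => by
    rwa [show (i + 1 : ℕ) = m by lia]
  simp only [mul_apply, superdiagonal, of_apply, conjTranspose_apply, diagonal_apply]
  rw [Fin.sum_univ_eq_sum_range (fun k => (if k = (i : ℕ) + 1 then c k else 0) *
    star (if k = (j : ℕ) + 1 then c k else 0)) m]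
  simp only [ite_mul, zero_mul, Finset.sum_ite_eq', Finset.mem_range, add_left_inj, Fin.val_inj]
  split_ifs with h1 h2 h2
  · rfl
  · simp
  · simp [hi (not_lt.mp h1)]
  · rfl

theorem conjTranspose_mul_superdiagonal (hc : c 0 = 0) :
    (superdiagonal m c)ᴴ * superdiagonal m c =
      diagonal fun i : Fin m => star (c i) * c i := by
  ext i j
  simp only [mul_apply, superdiagonal, of_apply, conjTranspose_apply, diagonal_apply]
  rw [Fin.sum_univ_eq_sum_range (fun k => star (if (i : ℕ) = k + 1 then c i else 0) *
    (if (j : ℕ) = k + 1 then c j else 0)) m]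
  obtain ⟨_ | i, hi⟩ := i
  · simp [hc]
  · rw [Finset.sum_eq_single i (fun k _ hk => by simp [Ne.symm hk])
      (fun h => absurd (Finset.mem_range.mpr (Nat.lt_of_succ_lt hi)) h), if_pos rfl, mul_ite,
      mul_zero]
    by_cases hj : (j : ℕ) = i + 1
    · simp [Fin.ext_iff, hj]
    · simp [Fin.ext_iff, hj, Ne.symm hj]

end Superdiagonal

section Irrep

variable (m : ℕ)

/-- The matrix `e_m`. -/
noncomputable def irrepE : Matrix (Fin m) (Fin m) ℂ :=
  superdiagonal m fun k => (√(k * (m - k)) : ℂ)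

theorem lie_irrepE_conjTranspose :
    ⁅irrepE m, (irrepE m)ᴴ⁆ = diagonal fun i : Fin m => (m : ℂ) - 1 - 2 * i := by
  have hsq (k : ℕ) (hk : k ≤ m) :
      (√(k * (m - k)) * star (√(k * (m - k)) : ℂ) : ℂ) = k * (m - k) := by
    have h : (0 : ℝ) ≤ k * (m - k) := mul_nonneg k.cast_nonneg (sub_nonneg.mpr (mod_cast hk))
    rw [Complex.star_def, Complex.conj_ofReal, ← Complex.ofReal_mul, Real.mul_self_sqrt h]
    push_cast
    rfl
  rw [Ring.lie_def, irrepE, superdiagonal_mul_conjTranspose (by simp),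
    conjTranspose_mul_superdiagonal (by simp), diagonal_sub]
  refine congrArg diagonal (funext fun i => ?_)
  rw [hsq _ i.2, mul_comm (star _), hsq _ i.2.le]
  push_cast
  ring

theorem isRaising_irrepE : IsRaising (irrepE m) := by
  ext i j
  rw [lie_irrepE_conjTranspose, lie_diagonal_apply, Matrix.smul_apply, smul_eq_mul, irrepE,
    superdiagonal, of_apply]
  split_ifs with h
  · rw [h]
    push_cast
    ring
  · simp

theorem irrep_eq_sl2Comb (M : Matrix (Fin 2) (Fin 2) ℂ) :
    irrep m M = sl2Comb (irrepE m) (M 0 0) (M 0 1) (M 1 0) := by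
  ext i j
  rw [sl2Comb, lie_irrepE_conjTranspose]
  simp only [irrep, irrepE, superdiagonal, of_apply, Matrix.add_apply, Matrix.smul_apply,
    conjTranspose_apply, diagonal_apply, smul_eq_mul, Fin.ext_iff]
  split_ifs <;> first | lia | simp

theorem sum_weight_irrep_sq :
    ∑ i : Fin m, ((m : ℝ) - 1 - 2 * i) ^ 2 = (m : ℝ) * (m ^ 2 - 1) / 3 := by
  have h (x : ℝ) (k : ℕ) : ∑ i ∈ Finset.range k, (x - 2 * (i : ℝ)) ^ 2 =
      k * x ^ 2 - 2 * x * (k * (k - 1)) + 2 * (k * (k - 1) * (2 * k - 1)) / 3 := by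
    induction k with
    | zero => simp
    | succ k ih =>
      rw [Finset.sum_range_succ, ih]
      push_cast
      ring
  rw [Fin.sum_univ_eq_sum_range fun i : ℕ => ((m : ℝ) - 1 - 2 * i) ^ 2, h]
  ring

end Irrep

section StandardSl2

variable {n : ℕ} (π : n.Partition)

/-- The `i`-th diagonal entry of the semisimple element `[E^π, (E^π)*]` of the standard `sl(2)`. -/
noncomputable def weight (i : Fin n) : ℝ :=
  (((sortedParts π).get ((blockEquiv π).symm i).1 : ℕ) : ℝ) - 1 -
    2 * ((((blockEquiv π).symm i).2 : ℕ) : ℝ)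

theorem stdRep_eq_submatrix (M : Matrix (Fin 2) (Fin 2) ℂ) :
    stdRep π M = (sl2Comb (blockDiagonal' fun p => irrepE ((sortedParts π).get p)) (M 0 0) (M 0 1)
      (M 1 0)).submatrix (blockEquiv π).symm (blockEquiv π).symm := by
  simp only [sl2Comb_blockDiagonal', ← irrep_eq_sl2Comb]
  rfl

theorem stdE_eq_submatrix :
    stdE π = (blockDiagonal' fun p => irrepE ((sortedParts π).get p)).submatrix
      (blockEquiv π).symm (blockEquiv π).symm := by
  simp [stdE, stdRep_eq_submatrix, sl2Comb]

theorem stdRep_eq_sl2Comb (M : Matrix (Fin 2) (Fin 2) ℂ) :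
    stdRep π M = sl2Comb (stdE π) (M 0 0) (M 0 1) (M 1 0) := by
  rw [stdRep_eq_submatrix, stdE_eq_submatrix, sl2Comb_submatrix]

theorem isRaising_stdE : IsRaising (stdE π) := by
  rw [stdE_eq_submatrix]
  exact (isRaising_blockDiagonal' fun p => isRaising_irrepE _).submatrix _

theorem lie_stdE_conjTranspose :
    ⁅stdE π, (stdE π)ᴴ⁆ = diagonal fun i => (weight π i : ℂ) := by
  rw [stdE_eq_submatrix, conjTranspose_submatrix, lie_submatrix_equiv,
    blockDiagonal'_conjTranspose, lie_blockDiagonal']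
  simp only [lie_irrepE_conjTranspose, blockDiagonal'_diagonal, submatrix_diagonal_equiv]
  congr 1
  ext i
  simp [weight]

variable {π} in
theorem mem_stdSl2_iff {B : Matrix (Fin n) (Fin n) ℂ} :
    B ∈ stdSl2 π ↔ B ∈ (isRaising_stdE π).toLieSubalgebra := by
  constructor
  · rintro ⟨M, -, rfl⟩
    exact ⟨_, _, _, (stdRep_eq_sl2Comb π M).symm⟩
  · rintro ⟨a, b, c, rfl⟩
    exact ⟨!![a, b; c, -a], by simp [trace_fin_two], by simp [stdRep_eq_sl2Comb]⟩

theorem normSq_diagonal (d : Fin n → ℝ) :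
    normSq (diagonal fun i => (d i : ℂ)) = ∑ i, d i ^ 2 := by
  simp [normSq, trace_diagonal, diagonal_conjTranspose, diagonal_mul_diagonal, ← sq,
    ← Complex.ofReal_pow]

theorem sum_weight_sq :
    ∑ i, weight π i ^ 2 = (π.parts.map fun m : ℕ => (m : ℝ) * ((m : ℝ) ^ 2 - 1)).sum / 3 := by
  have h : (π.parts.map fun m : ℕ => (m : ℝ) * ((m : ℝ) ^ 2 - 1)) =
      (((sortedParts π).map fun m : ℕ => (m : ℝ) * ((m : ℝ) ^ 2 - 1) : List ℝ) : Multiset ℝ) := by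
    rw [← Multiset.map_coe, sortedParts, Multiset.sort_eq]
  rw [h, Multiset.sum_coe, ← Fin.sum_univ_fun_getElem, ← (blockEquiv π).sum_comp,
    Fintype.sum_sigma, Finset.sum_div]
  refine Finset.sum_congr rfl fun p _ => ?_
  rw [← List.get_eq_getElem, ← sum_weight_irrep_sq]
  exact Finset.sum_congr rfl fun i _ => by rw [weight, Equiv.symm_apply_apply]

theorem normSq_stdE :
    normSq (stdE π) = (π.parts.map fun m : ℕ => (m : ℝ) * ((m : ℝ) ^ 2 - 1)).sum / 6 := by
  have h := (isRaising_stdE π).normSq_lie_conjTranspose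
  rw [lie_stdE_conjTranspose, normSq_diagonal, sum_weight_sq] at h
  linarith

end StandardSl2

/-! ### Representations of `sl(2)` with `f = e*` -/

theorem subsingleton_of_lie_eq_two_smul {k V : Type*} [Field k] [CharZero k] [AddCommGroup V]
    [Module k V] [FiniteDimensional k V] {h e : Module.End k V} (hhe : ⁅h, e⁆ = (2 : k) • e)
    (he : Function.Injective e) : Subsingleton V := by
  obtain ⟨u, hu⟩ := (Module.End.isUnit_iff e).mpr
    ⟨he, LinearMap.surjective_of_injective he⟩ |>.exists_left_inv
  have htrace := congrArg (fun X => LinearMap.trace k V (u * X)) hhe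
  simp only [Ring.lie_def, mul_sub, map_sub, mul_smul_comm, map_smul, hu, LinearMap.trace_one]
    at htrace
  rw [LinearMap.trace_mul_comm, mul_assoc, mul_eq_one_comm.mp hu, mul_one, ← mul_assoc, hu,
    one_mul, sub_self] at htrace
  have hdim : Module.finrank k V = 0 := by simpa using htrace.symm
  exact Module.finrank_zero_iff.mp hdim

theorem eq_bot_of_lie_eq_two_smul {k V : Type*} [Field k] [CharZero k] [AddCommGroup V]
    [Module k V] [FiniteDimensional k V] {h e : Module.End k V} (hhe : ⁅h, e⁆ = (2 : k) • e)
    {T : Submodule k V} (heT : ∀ x ∈ T, e x ∈ T) (hhT : ∀ x ∈ T, h x ∈ T)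
    (hker : ∀ x ∈ T, e x = 0 → x = 0) : T = ⊥ := by
  have hrestrict : ⁅h.restrict hhT, e.restrict heT⁆ = (2 : k) • e.restrict heT := by
    ext x
    exact LinearMap.congr_fun hhe x
  have hinj : Function.Injective (e.restrict heT) :=
    (injective_iff_map_eq_zero _).mpr fun x hx =>
      Subtype.ext (hker x x.2 (congrArg Subtype.val hx))
  exact T.subsingleton_iff_eq_bot.mp (subsingleton_of_lie_eq_two_smul hrestrict hinj)

theorem mem_ker_of_lie_eq_smul {R M : Type*} [CommRing R] [AddCommGroup M] [Module R M] {a : R}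
    {h e : Module.End R M} (hhe : ⁅h, e⁆ = a • e) {x : M} (hx : x ∈ LinearMap.ker e) :
    h x ∈ LinearMap.ker e := by
  have := LinearMap.congr_fun hhe x
  simpa [Ring.lie_def, LinearMap.mem_ker.mp hx] using this

section UnitaryRep

open Module InnerProductSpace

variable {V : Type*} [NormedAddCommGroup V] [InnerProductSpace ℂ V] [FiniteDimensional ℂ V]
  {h e : Module.End ℂ V}

theorem isSymmetric_of_isSl2Triple_adjoint (t : IsSl2Triple h e e.adjoint) :
    h.IsSymmetric := by
  rw [← t.lie_e_f, Ring.lie_def]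
  exact e.isSymmetric_self_comp_adjoint.sub e.isSymmetric_adjoint_mul_self

theorem exists_orthonormalBasis_ker_hasPrimitiveVectorWith (t : IsSl2Triple h e e.adjoint) :
    ∃ (r : ℕ) (N : Fin r → ℕ) (w : OrthonormalBasis (Fin r) ℂ (LinearMap.ker e)),
      ∀ p, t.HasPrimitiveVectorWith (w p : V) (N p : ℂ) := by
  have hsymm := (isSymmetric_of_isSl2Triple_adjoint t).restrict_invariant
    fun _ => mem_ker_of_lie_eq_smul (t.lie_h_e_smul ℂ)
  set w := hsymm.eigenvectorBasis rfl
  have hprim : ∀ p, t.HasPrimitiveVectorWith (w p : V) (hsymm.eigenvalues rfl p : ℂ) := fun p =>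
    ⟨fun h0 => w.orthonormal.ne_zero p (Subtype.ext h0),
      congrArg Subtype.val (hsymm.hasEigenvector_eigenvectorBasis rfl p).apply_eq_smul, (w p).2⟩
  choose N hN using fun p => (hprim p).exists_nat
  exact ⟨_, N, w, fun p => hN p ▸ hprim p⟩

section Strings

variable {t : IsSl2Triple h e e.adjoint} {v w : V} {μ ν : ℂ}

theorem inner_adjoint_pow_succ_succ (hw : t.HasPrimitiveVectorWith w ν) (k l : ℕ) :
    ⟪(e.adjoint ^ (k + 1)) v, (e.adjoint ^ (l + 1)) w⟫_ℂ =
      ((l + 1) * (ν - l)) * ⟪(e.adjoint ^ k) v, (e.adjoint ^ l) w⟫_ℂ := by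
  have he : e ((e.adjoint ^ (l + 1)) w) = ((l + 1) * (ν - l)) • (e.adjoint ^ l) w :=
    hw.lie_e_pow_succ_toEnd_f l
  rw [pow_succ', Module.End.mul_apply, LinearMap.adjoint_inner_left, he, inner_smul_right]

theorem inner_adjoint_pow_eq_zero (hv : t.HasPrimitiveVectorWith v μ)
    (hw : t.HasPrimitiveVectorWith w ν) {k l : ℕ} (h : ⟪v, w⟫_ℂ = 0 ∨ k ≠ l) :
    ⟪(e.adjoint ^ k) v, (e.adjoint ^ l) w⟫_ℂ = 0 := by
  have hev : e v = 0 := hv.lie_e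
  have hew : e w = 0 := hw.lie_e
  induction k generalizing l with
  | zero =>
    obtain _ | l := l
    · exact h.resolve_right (not_not.mpr rfl)
    · rw [pow_zero, pow_succ', Module.End.mul_apply, LinearMap.adjoint_inner_right,
        Module.End.one_apply, hev, inner_zero_left]
  | succ k ih =>
    obtain _ | l := l
    · rw [pow_zero, pow_succ', Module.End.mul_apply, LinearMap.adjoint_inner_left,
        Module.End.one_apply, hew, inner_zero_right]
    · rw [inner_adjoint_pow_succ_succ hw, ih (h.imp_right (by simp)), mul_zero]

variable {N : ℕ}

theorem norm_adjoint_pow_succ (hv : t.HasPrimitiveVectorWith v (N : ℂ)) {k : ℕ} (hk : k ≤ N) :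
    ‖(e.adjoint ^ (k + 1)) v‖ = √((k + 1) * (N - k)) * ‖(e.adjoint ^ k) v‖ := by
  have hnonneg : (0 : ℝ) ≤ (k + 1) * (N - k) :=
    mul_nonneg (by positivity) (sub_nonneg.mpr (by exact_mod_cast hk))
  have hsq : ‖(e.adjoint ^ (k + 1)) v‖ ^ 2 = (k + 1) * (N - k) * ‖(e.adjoint ^ k) v‖ ^ 2 := by
    have := inner_adjoint_pow_succ_succ (v := v) hv k k
    rw [inner_self_eq_norm_sq_to_K, inner_self_eq_norm_sq_to_K] at this
    apply Complex.ofReal_injective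
    push_cast
    exact this
  rw [← sq_eq_sq₀ (norm_nonneg _) (by positivity), hsq, mul_pow, Real.sq_sqrt hnonneg]

theorem norm_adjoint_pow_ne_zero (hv : t.HasPrimitiveVectorWith v (N : ℂ)) {k : ℕ} (hk : k ≤ N) :
    ‖(e.adjoint ^ k) v‖ ≠ 0 :=
  norm_ne_zero_iff.mpr (hv.pow_toEnd_f_ne_zero_of_eq_nat rfl hk)

theorem adjoint_pow_eq_zero (hv : t.HasPrimitiveVectorWith v (N : ℂ)) {k : ℕ} (hk : N < k) :
    (e.adjoint ^ k) v = 0 := by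
  obtain ⟨j, rfl⟩ := Nat.exists_eq_add_of_le' hk
  rw [pow_add, Module.End.mul_apply,
    show (e.adjoint ^ (N + 1)) v = 0 from hv.pow_toEnd_f_eq_zero_of_eq_nat rfl, map_zero]

/-- The `k`-th vector of the string of a primitive vector `v`, normalized. -/
noncomputable def stringVec (e : Module.End ℂ V) (v : V) (k : ℕ) : V :=
  (‖(e.adjoint ^ k) v‖ : ℂ)⁻¹ • (e.adjoint ^ k) v

theorem adjoint_pow_eq_norm_smul_stringVec (k : ℕ) :
    (e.adjoint ^ k) v = (‖(e.adjoint ^ k) v‖ : ℂ) • stringVec e v k := by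
  by_cases h0 : (e.adjoint ^ k) v = 0
  · simp [h0]
  · rw [stringVec, smul_smul, mul_inv_cancel₀, one_smul]
    exact_mod_cast norm_ne_zero_iff.mpr h0

theorem map_stringVec_succ (hv : t.HasPrimitiveVectorWith v (N : ℂ)) {k : ℕ} (hk : k < N) :
    e (stringVec e v (k + 1)) = (√((k + 1) * (N - k)) : ℂ) • stringVec e v k := by
  have he : e ((e.adjoint ^ (k + 1)) v) = (((k : ℂ) + 1) * (N - k)) • (e.adjoint ^ k) v :=
    hv.lie_e_pow_succ_toEnd_f k
  have hpos : (0 : ℝ) < (k + 1) * (N - k) :=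
    mul_pos (by positivity) (sub_pos.mpr (by exact_mod_cast hk))
  have hsqrt : (√((k + 1) * (N - k)) : ℂ) ≠ 0 := by exact_mod_cast (Real.sqrt_pos.mpr hpos).ne'
  have hsq : ((k : ℂ) + 1) * (N - k) = √((k + 1) * (N - k)) * √((k + 1) * (N - k)) := by
    rw [← Complex.ofReal_mul, Real.mul_self_sqrt hpos.le]
    push_cast
    ring
  have hnorm : (‖(e.adjoint ^ k) v‖ : ℂ) ≠ 0 := by
    exact_mod_cast norm_adjoint_pow_ne_zero hv hk.le
  rw [stringVec, stringVec, map_smul, he, norm_adjoint_pow_succ hv hk.le, smul_smul, smul_smul,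
    hsq]
  congr 1
  push_cast
  field_simp

end Strings

section StringBasis

variable {t : IsSl2Triple h e e.adjoint} {r : ℕ} {N : Fin r → ℕ}
  {w : OrthonormalBasis (Fin r) ℂ (LinearMap.ker e)}

theorem orthonormal_stringVec (hw : ∀ p, t.HasPrimitiveVectorWith (w p : V) (N p : ℂ)) :
    Orthonormal ℂ fun i : Σ p : Fin r, Fin (N p + 1) => stringVec e (w i.1 : V) i.2 := by
  refine ⟨fun ⟨p, k⟩ => ?_, fun ⟨p, k⟩ ⟨q, l⟩ hne => ?_⟩
  · have := norm_adjoint_pow_ne_zero (hw p) (Nat.lt_succ_iff.mp k.2)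
    simp only [stringVec, norm_smul, norm_inv, Complex.norm_real, norm_norm, inv_mul_cancel₀ this]
  · have hpq : ⟪(w p : V), w q⟫_ℂ = 0 ∨ (k : ℕ) ≠ l := by
      by_cases hpq : p = q
      · subst hpq
        exact Or.inr fun hkl => hne (by rw [Fin.ext hkl])
      · exact Or.inl (w.orthonormal.2 hpq)
    simp only [stringVec, inner_smul_left, inner_smul_right,
      inner_adjoint_pow_eq_zero (hw p) (hw q) hpq, mul_zero]

theorem span_adjoint_pow_eq_top (hw : ∀ p, t.HasPrimitiveVectorWith (w p : V) (N p : ℂ)) :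
    Submodule.span ℂ (Set.range fun i : Fin r × ℕ => (e.adjoint ^ i.2) (w i.1 : V)) = ⊤ := by
  set S := Submodule.span ℂ (Set.range fun i : Fin r × ℕ => (e.adjoint ^ i.2) (w i.1 : V))
  have hmem : ∀ p k, (e.adjoint ^ k) (w p : V) ∈ S := fun p k =>
    Submodule.subset_span ⟨(p, k), rfl⟩
  have hstable : ∀ g : Module.End ℂ V, (∀ p k, g ((e.adjoint ^ k) (w p : V)) ∈ S) →
      ∀ x ∈ S, g x ∈ S := fun g hg x hx =>
    (Submodule.span_le (p := S.comap g)).mpr (by rintro _ ⟨⟨p, k⟩, rfl⟩; exact hg p k) hx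
  have hfS : ∀ x ∈ S, e.adjoint x ∈ S := hstable _ fun p k => by
    rw [← Module.End.mul_apply, ← pow_succ']
    exact hmem p (k + 1)
  have hhS : ∀ x ∈ S, h x ∈ S := hstable _ fun p k => by
    rw [show h ((e.adjoint ^ k) (w p : V)) = _ from (hw p).lie_h_pow_toEnd_f k]
    exact S.smul_mem _ (hmem p k)
  have hkerS : LinearMap.ker e ≤ S := fun x hx => by
    have hsum : ((∑ p, w.repr ⟨x, hx⟩ p • w p : LinearMap.ker e) : V) ∈ S := by
      rw [Submodule.coe_sum]
      exact S.sum_mem fun p _ => S.smul_mem _ (hmem p 0)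
    rwa [w.sum_repr] at hsum
  rw [← Submodule.orthogonal_eq_bot_iff]
  refine eq_bot_of_lie_eq_two_smul (t.lie_h_e_smul ℂ) (fun x hx y hy => ?_) (fun x hx y hy => ?_)
    fun x hx hex => ?_
  · rw [← LinearMap.adjoint_inner_left]
    exact hx _ (hfS y hy)
  · rw [← isSymmetric_of_isSl2Triple_adjoint t y x]
    exact hx _ (hhS y hy)
  · exact inner_self_eq_zero.mp (hx x (hkerS hex))

theorem span_stringVec_eq_top (hw : ∀ p, t.HasPrimitiveVectorWith (w p : V) (N p : ℂ)) :
    Submodule.span ℂ (Set.range fun i : Σ p : Fin r, Fin (N p + 1) =>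
      stringVec e (w i.1 : V) i.2) = ⊤ := by
  rw [eq_top_iff, ← span_adjoint_pow_eq_top hw, Submodule.span_le]
  rintro _ ⟨⟨p, k⟩, rfl⟩
  obtain hk | hk := lt_or_ge (N p) k
  · simp only [adjoint_pow_eq_zero (hw p) hk]
    exact Submodule.zero_mem _
  · beta_reduce
    rw [adjoint_pow_eq_norm_smul_stringVec]
    exact Submodule.smul_mem _ _
      (Submodule.subset_span ⟨⟨p, ⟨k, Nat.lt_succ_of_le hk⟩⟩, rfl⟩)

end StringBasis

theorem exists_orthonormalBasis_toMatrix_eq_blockDiagonal' (t : IsSl2Triple h e e.adjoint) :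
    ∃ (r : ℕ) (m : Fin r → ℕ) (b : OrthonormalBasis (Σ p : Fin r, Fin (m p)) ℂ V), (∀ p, 0 < m p) ∧
      LinearMap.toMatrix b.toBasis b.toBasis e = blockDiagonal' fun p => irrepE (m p) := by
  obtain ⟨r, N, w, hw⟩ := exists_orthonormalBasis_ker_hasPrimitiveVectorWith t
  refine ⟨r, fun p => N p + 1, .mk (orthonormal_stringVec hw) (span_stringVec_eq_top hw).ge,
    fun p => Nat.succ_pos _, ?_⟩
  set b : OrthonormalBasis (Σ p : Fin r, Fin (N p + 1)) ℂ V :=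
    .mk (orthonormal_stringVec hw) (span_stringVec_eq_top hw).ge
  have hb : ∀ p k, b ⟨p, k⟩ = stringVec e (w p : V) k := fun p k => by
    simp only [b, OrthonormalBasis.coe_mk]
  ext ⟨q, i⟩ ⟨p, k, hk⟩
  have hrepr : ∀ l, b.repr (b ⟨p, l⟩) ⟨q, i⟩ = if q = p ∧ (i : ℕ) = l then 1 else 0 := fun l => by
    rw [b.repr_self, PiLp.single_apply]
    congr 1
    simp only [Sigma.mk.injEq, eq_iff_iff]
    refine and_congr_right ?_
    rintro rfl
    rw [heq_iff_eq, Fin.ext_iff]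
  rw [LinearMap.toMatrix_apply, OrthonormalBasis.coe_toBasis, hb,
    OrthonormalBasis.coe_toBasis_repr_apply]
  obtain _ | k := k
  · have hker : e (w p : V) = 0 := (w p).2
    rcases eq_or_ne q p with rfl | hqp
    · simp [stringVec, hker, irrepE, superdiagonal, blockDiagonal'_apply_eq]
    · simp [stringVec, hker, blockDiagonal'_apply_ne _ _ _ hqp]
  · rw [map_stringVec_succ (hw p) (Nat.succ_lt_succ_iff.mp hk), ← hb p ⟨k, Nat.lt_of_succ_lt hk⟩,
      map_smul, PiLp.smul_apply, hrepr]
    rcases eq_or_ne q p with rfl | hqp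
    · have hcoeff : ((k + 1 : ℕ) : ℝ) * ((N q + 1 : ℕ) - (k + 1 : ℕ)) = (k + 1) * (N q - k) := by
        push_cast
        ring
      simp only [true_and, smul_eq_mul, mul_ite, mul_one, mul_zero, irrepE, superdiagonal,
        blockDiagonal'_apply_eq, of_apply, hcoeff, add_left_inj, @eq_comm _ k]
    · simp [hqp, blockDiagonal'_apply_ne _ _ _ hqp]

end UnitaryRep

theorem exists_equiv_of_map_univ_eq {α β γ : Type*} [Fintype α] [Fintype β] {f : α → γ} {g : β → γ}
    (h : Finset.univ.val.map f = Finset.univ.val.map g) : ∃ σ : α ≃ β, ∀ a, g (σ a) = f a := by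
  classical
  have hcard : ∀ c, Fintype.card {a // f a = c} = Fintype.card {b // g b = c} := fun c => by
    have := congrArg (Multiset.count c) h
    rw [Multiset.count_map, Multiset.count_map] at this
    rw [Fintype.card_subtype, Fintype.card_subtype]
    simpa [Finset.card, eq_comm] using this
  let fiberEquiv : ∀ c, {a // f a = c} ≃ {b // g b = c} := fun c => Fintype.equivOfCardEq (hcard c)
  exact ⟨(Equiv.sigmaFiberEquiv f).symm.trans
    ((Equiv.sigmaCongrRight fiberEquiv).trans (Equiv.sigmaFiberEquiv g)),
    fun a => (fiberEquiv (f a) ⟨a, rfl⟩).2⟩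

/-! ### Unitary conjugacy to the standard `sl(2)` -/

theorem blockDiagonal'_submatrix_sigmaCongr {α β R : Type*} [DecidableEq α] [DecidableEq β]
    [Zero R] {m : α → ℕ} {m' : β → ℕ} (σ : α ≃ β) (hσ : ∀ p, m p = m' (σ p))
    (B : ∀ k, Matrix (Fin k) (Fin k) R) :
    (blockDiagonal' fun q => B (m' q)).submatrix
        (Equiv.sigmaCongr σ fun p => finCongr (hσ p)) (Equiv.sigmaCongr σ fun p => finCongr (hσ p))
      = blockDiagonal' fun p => B (m p) := by
  obtain rfl : m = m' ∘ σ := funext hσ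
  ext ⟨p, i⟩ ⟨q, j⟩
  rcases eq_or_ne p q with rfl | hpq
  · rw [blockDiagonal'_apply_eq]
    exact blockDiagonal'_apply_eq (fun q => B (m' q)) (σ p) i j
  · rw [blockDiagonal'_apply_ne _ _ _ hpq]
    exact blockDiagonal'_apply_ne (fun q => B (m' q)) i j (σ.injective.ne hpq)

theorem exists_stdE_eq_submatrix {r n : ℕ} {m : Fin r → ℕ} (hpos : ∀ p, 0 < m p)
    (hsum : ∑ p, m p = n) : ∃ (π : n.Partition) (φ : Fin n ≃ Σ p, Fin (m p)),
      stdE π = (blockDiagonal' fun p => irrepE (m p)).submatrix φ φ := by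
  let π : n.Partition :=
    { parts := Finset.univ.val.map m
      parts_pos := by
        intro i hi
        obtain ⟨p, -, rfl⟩ := Multiset.mem_map.mp hi
        exact hpos p
      parts_sum := hsum }
  obtain ⟨σ, hσ⟩ := exists_equiv_of_map_univ_eq (f := (sortedParts π).get) (g := m) (by
    rw [Fin.univ_val_map, List.ofFn_get, sortedParts, Multiset.sort_eq])
  refine ⟨π, (blockEquiv π).symm.trans (Equiv.sigmaCongr σ fun i => finCongr (hσ i).symm), ?_⟩
  rw [stdE_eq_submatrix, ← blockDiagonal'_submatrix_sigmaCongr σ fun p => (hσ p).symm]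
  rfl

theorem exists_unitary_conj_submatrix {ι κ : Type*} [Fintype ι] [DecidableEq ι] [Fintype κ]
    [DecidableEq κ] (A : Matrix ι ι ℂ) (b : OrthonormalBasis κ ℂ (EuclideanSpace ℂ ι))
    (φ : ι ≃ κ) : ∃ U ∈ unitaryGroup ι ℂ, A = U *
      (LinearMap.toMatrix b.toBasis b.toBasis (toEuclideanLin A)).submatrix φ φ * Uᴴ := by
  set b' := b.reindex φ.symm
  set s := EuclideanSpace.basisFun ι ℂ
  have hmem := s.toMatrix_orthonormalBasis_mem_unitary b'
  have hA : LinearMap.toMatrix s.toBasis s.toBasis (toEuclideanLin A) = A := by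
    rw [toEuclideanLin_eq_toLin_orthonormal, LinearMap.toMatrix_toLin]
  have hb' : (LinearMap.toMatrix b.toBasis b.toBasis (toEuclideanLin A)).submatrix φ φ =
      LinearMap.toMatrix b'.toBasis b'.toBasis (toEuclideanLin A) := by
    ext i j
    simp [LinearMap.toMatrix_apply, b']
  have hinv : (s.toBasis.toMatrix b'.toBasis)ᴴ = b'.toBasis.toMatrix s.toBasis := by
    refine left_inv_eq_right_inv ?_ (s.toBasis.toMatrix_mul_toMatrix_flip b'.toBasis)
    rw [OrthonormalBasis.coe_toBasis]
    exact mem_unitaryGroup_iff'.mp hmem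
  refine ⟨s.toBasis.toMatrix b'.toBasis, by rwa [OrthonormalBasis.coe_toBasis], ?_⟩
  rw [hb', hinv]
  conv_lhs => rw [← hA]
  rw [basis_toMatrix_mul_linearMap_toMatrix_mul_basis_toMatrix]

section SpecialUnitary

variable {n : ℕ}

theorem toEuclideanLin_lie {ι : Type*} [Fintype ι] [DecidableEq ι] (A B : Matrix ι ι ℂ) :
    toEuclideanLin ⁅A, B⁆ =
      (⁅toEuclideanLin A, toEuclideanLin B⁆ : Module.End ℂ (EuclideanSpace ℂ ι)) := by
  simp only [Ring.lie_def, map_sub, toLpLin_mul_same, Module.End.mul_eq_comp]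

theorem IsRaising.isSl2Triple_toEuclideanLin {ι : Type*} [Fintype ι] [DecidableEq ι]
    {E : Matrix ι ι ℂ} (hE : IsRaising E) (hE0 : E ≠ 0) :
    IsSl2Triple (toEuclideanLin ⁅E, Eᴴ⁆ : Module.End ℂ (EuclideanSpace ℂ ι))
      (toEuclideanLin E) (toEuclideanLin E).adjoint := by
  rw [← toEuclideanLin_conjTranspose_eq_adjoint]
  refine ⟨?_, (toEuclideanLin_lie _ _).symm, ?_, ?_⟩
  · rw [map_ne_zero_iff _ toEuclideanLin.injective]
    intro h0
    have h2 : (2 : ℂ) • E = 0 := by rw [← hE, h0, zero_lie]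
    exact hE0 ((smul_eq_zero.mp h2).resolve_left two_ne_zero)
  · rw [← toEuclideanLin_lie, hE, map_smul, two_smul, two_smul]
  · rw [← toEuclideanLin_lie, hE.lie_lie_conjTranspose, map_neg, map_smul, two_smul, two_smul]

theorem IsRaising.exists_unitary_conj_stdE {E : Matrix (Fin n) (Fin n) ℂ}
    (hE : IsRaising E) (hE0 : E ≠ 0) :
    ∃ U ∈ unitaryGroup (Fin n) ℂ, ∃ π : n.Partition, E = U * stdE π * Uᴴ := by
  obtain ⟨r, m, b, hpos, hb⟩ :=
    exists_orthonormalBasis_toMatrix_eq_blockDiagonal' (hE.isSl2Triple_toEuclideanLin hE0)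
  have hsum : ∑ p, m p = n := by
    have hcard := Module.finrank_eq_card_basis b.toBasis
    rw [finrank_euclideanSpace_fin, Fintype.card_sigma] at hcard
    simpa using hcard.symm
  obtain ⟨π, φ, hπ⟩ := exists_stdE_eq_submatrix hpos hsum
  obtain ⟨U, hU, hEU⟩ := exists_unitary_conj_submatrix E b φ
  exact ⟨U, hU, π, by rwa [hπ, ← hb]⟩

theorem exists_specialUnitary_conj_eq {U : Matrix (Fin n) (Fin n) ℂ}
    (hU : U ∈ unitaryGroup (Fin n) ℂ) :
    ∃ U' ∈ specialUnitaryGroup (Fin n) ℂ, ∀ B, U' * B * U'ᴴ = U * B * Uᴴ := by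
  rcases Nat.eq_zero_or_pos n with rfl | hn
  · exact ⟨U, mem_specialUnitaryGroup_iff.mpr ⟨hU, by simp⟩, fun _ => rfl⟩
  have hdet : ‖U.det‖ = 1 := CStarRing.norm_of_mem_unitary (det_of_mem_unitary hU)
  obtain ⟨c, hc⟩ := IsAlgClosed.exists_pow_nat_eq (U.det)⁻¹ hn
  have hnorm : ‖c‖ = 1 := by
    have := congrArg norm hc
    rw [norm_pow, norm_inv, hdet, inv_one] at this
    exact (pow_eq_one_iff_of_nonneg (norm_nonneg _) hn.ne').mp this
  have hcc : c * star c = 1 := by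
    rw [RCLike.star_def, Complex.mul_conj, Complex.normSq_eq_norm_sq, hnorm]
    norm_num
  refine ⟨c • U, mem_specialUnitaryGroup_iff.mpr ⟨?_, ?_⟩, fun B => ?_⟩
  · rw [mem_unitaryGroup_iff, star_eq_conjTranspose, conjTranspose_smul, smul_mul_smul_comm, hcc,
      one_smul]
    exact mem_unitaryGroup_iff.mp hU
  · rw [det_smul, Fintype.card_fin, hc, inv_mul_cancel₀]
    rw [← norm_ne_zero_iff, hdet]
    exact one_ne_zero
  · rw [conjTranspose_smul, Matrix.smul_mul, smul_mul_smul_comm, hcc, one_smul]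

section UnitaryConj

variable {ι R : Type*} [Fintype ι] [CommRing R] [StarRing R]

theorem conjTranspose_unitary_conj (U X : Matrix ι ι R) : (U * X * Uᴴ)ᴴ = U * Xᴴ * Uᴴ := by
  simp only [conjTranspose_mul, conjTranspose_conjTranspose, Matrix.mul_assoc]

variable [DecidableEq ι] {U : Matrix ι ι R} (hU : U ∈ unitaryGroup ι R)

include hU

theorem unitary_conj_mul (X Y : Matrix ι ι R) :
    (U * X * Uᴴ) * (U * Y * Uᴴ) = U * (X * Y) * Uᴴ := by
  rw [show (U * X * Uᴴ) * (U * Y * Uᴴ) = U * X * (Uᴴ * U) * (Y * Uᴴ) by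
    simp only [Matrix.mul_assoc], show Uᴴ * U = 1 from mem_unitaryGroup_iff'.mp hU]
  simp only [Matrix.mul_one, Matrix.mul_assoc]

theorem trace_unitary_conj (X : Matrix ι ι R) : (U * X * Uᴴ).trace = X.trace := by
  rw [trace_mul_comm, ← Matrix.mul_assoc, show Uᴴ * U = 1 from mem_unitaryGroup_iff'.mp hU,
    Matrix.one_mul]

theorem lie_unitary_conj (X Y : Matrix ι ι R) :
    ⁅U * X * Uᴴ, U * Y * Uᴴ⁆ = U * ⁅X, Y⁆ * Uᴴ := by
  rw [Ring.lie_def, Ring.lie_def, unitary_conj_mul hU, unitary_conj_mul hU, Matrix.mul_sub,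
    Matrix.sub_mul]

theorem sl2Comb_unitary_conj (E : Matrix ι ι R) (a b c : R) :
    sl2Comb (U * E * Uᴴ) a b c = U * sl2Comb E a b c * Uᴴ := by
  simp only [sl2Comb, conjTranspose_unitary_conj, lie_unitary_conj hU, Matrix.mul_add,
    Matrix.add_mul, Matrix.mul_smul, Matrix.smul_mul]

theorem IsRaising.unitary_conj {E : Matrix ι ι R} (hE : IsRaising E) :
    IsRaising (U * E * Uᴴ) := by
  rw [IsRaising, conjTranspose_unitary_conj, lie_unitary_conj hU, lie_unitary_conj hU, hE,
    Matrix.mul_smul, Matrix.smul_mul]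

end UnitaryConj

theorem IsRaising.exists_specialUnitary_conj_stdE {E : Matrix (Fin n) (Fin n) ℂ}
    (hE : IsRaising E) (hE0 : E ≠ 0) : ∃ U ∈ specialUnitaryGroup (Fin n) ℂ, ∃ π : n.Partition,
      ∀ a b c, sl2Comb E a b c = U * sl2Comb (stdE π) a b c * Uᴴ := by
  obtain ⟨U, hU, π, hEU⟩ := hE.exists_unitary_conj_stdE hE0
  obtain ⟨U', hU', hconj⟩ := exists_specialUnitary_conj_eq hU
  refine ⟨U', hU', π, fun a b c => ?_⟩
  rw [hEU, sl2Comb_unitary_conj hU, hconj]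

end SpecialUnitary

/-! ### The derivative of `K` along an orbit -/

section SpecialLinearGroup

variable {ι R : Type*} [Fintype ι] [DecidableEq ι] [CommRing R] (g : SpecialLinearGroup ι R)

theorem coe_mul_coe_inv :
    (g : Matrix ι ι R) * ((g⁻¹ : SpecialLinearGroup ι R) : Matrix ι ι R) = 1 :=
  congrArg Subtype.val (mul_inv_cancel g)

theorem coe_inv_mul_coe :
    ((g⁻¹ : SpecialLinearGroup ι R) : Matrix ι ι R) * (g : Matrix ι ι R) = 1 :=
  congrArg Subtype.val (inv_mul_cancel g)

end SpecialLinearGroup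

section Ad

variable {n : ℕ} (g : SpecialLinearGroup (Fin n) ℂ) (A B : Matrix (Fin n) (Fin n) ℂ)

theorem Ad_one : Ad 1 A = A := by
  simp [Ad]

theorem Ad_mul : Ad g (A * B) = Ad g A * Ad g B := by
  simp only [Ad, Matrix.mul_assoc]
  rw [← Matrix.mul_assoc (g⁻¹ : SpecialLinearGroup (Fin n) ℂ).1 g.1, coe_inv_mul_coe,
    Matrix.one_mul]

theorem Ad_pow (k : ℕ) : Ad g (A ^ k) = Ad g A ^ k := by
  induction k with
  | zero => rw [pow_zero, pow_zero, Ad, Matrix.mul_one, coe_mul_coe_inv]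
  | succ k ih => rw [pow_succ, pow_succ, Ad_mul, ih]

theorem trace_Ad : (Ad g A).trace = A.trace := by
  rw [Ad, trace_mul_comm, ← Matrix.mul_assoc, coe_inv_mul_coe, Matrix.one_mul]

theorem mem_orbit_self : A ∈ orbit A :=
  ⟨1, (Ad_one A).symm⟩

theorem Ad_Ad (h : SpecialLinearGroup (Fin n) ℂ) : Ad g (Ad h A) = Ad (g * h) A := by
  simp [Ad, Matrix.mul_assoc]

end Ad

section OrbitCalculus

open scoped Matrix.Norms.Operator

section MatrixCurve

variable {n : ℕ} {F G : ℝ → Matrix (Fin n) (Fin n) ℂ} {F' G' : Matrix (Fin n) (Fin n) ℂ} {t : ℝ}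

theorem hasDerivAt_matrix :
    HasDerivAt F F' t ↔ ∀ i j, HasDerivAt (fun s => F s i j) (F' i j) t :=
  ⟨fun h i j => hasDerivAt_pi.mp (hasDerivAt_pi.mp h i) j,
    fun h => hasDerivAt_pi.mpr fun i => hasDerivAt_pi.mpr fun j => h i j⟩

theorem differentiableAt_matrix :
    DifferentiableAt ℝ F t ↔ ∀ i j, DifferentiableAt ℝ (fun s => F s i j) t :=
  ⟨fun h i j => differentiableAt_pi.mp (differentiableAt_pi.mp h i) j,
    fun h => differentiableAt_pi.mpr fun i => differentiableAt_pi.mpr fun j => h i j⟩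

theorem hasDerivAt_conjTranspose (hF : HasDerivAt F F' t) :
    HasDerivAt (fun s => (F s)ᴴ) F'ᴴ t :=
  hasDerivAt_matrix.mpr fun i j => (hasDerivAt_matrix.mp hF j i).star

theorem hasDerivAt_lie (hF : HasDerivAt F F' t) (hG : HasDerivAt G G' t) :
    HasDerivAt (fun s => ⁅F s, G s⁆) (⁅F', G t⁆ + ⁅F t, G'⁆) t := by
  simp only [Ring.lie_def]
  exact ((hF.fun_mul hG).fun_sub (hG.fun_mul hF)).congr_deriv (by abel)

theorem hasDerivAt_trace (hF : HasDerivAt F F' t) :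
    HasDerivAt (fun s => (F s).trace) F'.trace t :=
  HasDerivAt.fun_sum fun i _ => hasDerivAt_matrix.mp hF i i

theorem hasDerivAt_normSq (hF : HasDerivAt F F' t) :
    HasDerivAt (fun s => normSq (F s)) (2 * (F' * (F t)ᴴ).trace.re) t := by
  have h := Complex.reCLM.hasFDerivAt.comp_hasDerivAt t
    (hasDerivAt_trace (hF.fun_mul (hasDerivAt_conjTranspose hF)))
  refine h.congr_deriv ?_
  rw [Complex.reCLM_apply, trace_add, Complex.add_re, ← star_trace_mul_conjTranspose F' (F t),
    Complex.star_def, Complex.conj_re, two_mul]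

end MatrixCurve

section AdCurve

variable {n : ℕ} {g : ℝ → SpecialLinearGroup (Fin n) ℂ} (hg0 : g 0 = 1)
  {M : Matrix (Fin n) (Fin n) ℂ} (hg : HasDerivAt (fun t => (g t : Matrix (Fin n) (Fin n) ℂ)) M 0)
  {A : Matrix (Fin n) (Fin n) ℂ}

include hg0 hg

theorem hasDerivAt_coe_inv :
    HasDerivAt (fun t => ((g t)⁻¹ : SpecialLinearGroup (Fin n) ℂ).1) (-M) 0 := by
  have hinv (t : ℝ) : ((g t)⁻¹ : SpecialLinearGroup (Fin n) ℂ).1 = Ring.inverse (g t).1 :=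
    (Ring.inverse_unit ⟨_, _, coe_mul_coe_inv (g t), coe_inv_mul_coe (g t)⟩).symm
  have h0 : (g 0).1 = (1 : (Matrix (Fin n) (Fin n) ℂ)ˣ) := congrArg Subtype.val hg0
  have h := (h0 ▸ hasFDerivAt_ringInverse (𝕜 := ℝ) 1).comp_hasDerivAt (0 : ℝ) hg
  simp only [h0, Units.val_one, _root_.neg_apply, ContinuousLinearMap.mulLeftRight_apply,
    Matrix.one_mul, Matrix.mul_one] at h
  simp only [hinv]
  exact h

theorem hasDerivAt_Ad : HasDerivAt (fun t => Ad (g t) A) ⁅M, A⁆ 0 := by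
  refine ((hg.mul_const A).fun_mul (hasDerivAt_coe_inv hg0 hg)).congr_deriv ?_
  simp [hg0, Ring.lie_def, sub_eq_add_neg]

theorem hasDerivAt_gramDet_Ad :
    HasDerivAt (fun t => gramDet (Ad (g t) A)) (4 * normSq A * (M * ⁅A, Aᴴ⁆).trace.re) 0 := by
  simp only [gramDet, ← Ad_pow, trace_Ad]
  refine (((hasDerivAt_normSq (hasDerivAt_Ad hg0 hg)).fun_pow 2).sub_const _).congr_deriv ?_
  rw [hg0, Ad_one, trace_lie_mul]
  push_cast
  ring

theorem hasDerivAt_normSq_lie_Ad :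
    HasDerivAt (fun t => normSq ⁅Ad (g t) A, (Ad (g t) A)ᴴ⁆)
      (4 * (M * ⁅A, ⁅Aᴴ, ⁅A, Aᴴ⁆⁆⁆).trace.re) 0 := by
  have hAd := hasDerivAt_Ad (A := A) hg0 hg
  refine (hasDerivAt_normSq (hasDerivAt_lie hAd (hasDerivAt_conjTranspose hAd))).congr_deriv ?_
  have h₁ : (⁅⁅M, A⁆, Aᴴ⁆ * ⁅A, Aᴴ⁆).trace = (M * ⁅A, ⁅Aᴴ, ⁅A, Aᴴ⁆⁆⁆).trace := by
    rw [trace_lie_mul, trace_lie_mul]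
  have h₂ : (⁅A, ⁅M, A⁆ᴴ⁆ * ⁅A, Aᴴ⁆).trace = star (⁅⁅M, A⁆, Aᴴ⁆ * ⁅A, Aᴴ⁆).trace := by
    rw [← trace_conjTranspose, conjTranspose_mul, conjTranspose_lie_conjTranspose_self,
      conjTranspose_lie ⁅M, A⁆, conjTranspose_conjTranspose, trace_mul_comm]
  rw [hg0, Ad_one, conjTranspose_lie_conjTranspose_self, Matrix.add_mul, trace_add, h₂, h₁,
    Complex.add_re, Complex.star_def, Complex.conj_re]
  ring

theorem hasDerivAt_K_Ad (hA : gramDet A ≠ 0) :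
    HasDerivAt (fun t => K (Ad (g t) A)) (4 / gramDet A ^ 2 * (M * critGrad A).trace.re) 0 := by
  refine ((hasDerivAt_normSq_lie_Ad hg0 hg).fun_div (hasDerivAt_gramDet_Ad hg0 hg)
    (by rwa [hg0, Ad_one])).congr_deriv ?_
  rw [hg0, Ad_one, critGrad, Matrix.mul_sub, Matrix.mul_smul, Matrix.mul_smul, trace_sub,
    trace_smul, trace_smul, smul_eq_mul, smul_eq_mul, Complex.sub_re, ← Complex.ofReal_mul,
    Complex.re_ofReal_mul, Complex.re_ofReal_mul]
  field_simp

end AdCurve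

theorem exists_specialLinearGroup_hasDerivAt {n : ℕ} {X : Matrix (Fin n) (Fin n) ℂ}
    (hX : X.IsHermitian) (htr : X.trace = 0) :
    ∃ g : ℝ → SpecialLinearGroup (Fin n) ℂ, g 0 = 1 ∧
      HasDerivAt (fun t => (g t : Matrix (Fin n) (Fin n) ℂ)) X 0 := by
  set U : Matrix (Fin n) (Fin n) ℂ := hX.eigenvectorUnitary.1
  set d := hX.eigenvalues
  have hU : U * star U = 1 := Unitary.coe_mul_star_self _
  have hXU : X = U * diagonal (fun i => (d i : ℂ)) * star U := by
    conv_lhs => rw [hX.spectral_theorem, Unitary.conjStarAlgAut_apply]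
    rfl
  have hd : ∑ i, (d i : ℂ) = 0 := htr ▸ hX.trace_eq_sum_eigenvalues.symm
  have hdet (t : ℝ) : (U * diagonal (fun i => Complex.exp (t * d i)) * star U).det = 1 := by
    rw [det_mul_right_comm, hU, Matrix.one_mul, det_diagonal, ← Complex.exp_sum, ← Finset.mul_sum,
      hd, mul_zero, Complex.exp_zero]
  have hexp : HasDerivAt (fun t : ℝ => diagonal fun i => Complex.exp (t * d i))
      (diagonal fun i => (d i : ℂ)) 0 := by
    refine hasDerivAt_matrix.mpr fun i j => ?_
    obtain rfl | hij := eq_or_ne i j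
    · simpa using ((Complex.ofRealCLM.hasDerivAt (x := (0 : ℝ))).mul_const (d i : ℂ)).cexp
    · simpa only [diagonal_apply_ne _ hij] using hasDerivAt_const _ _
  refine ⟨fun t => ⟨_, hdet t⟩, Subtype.ext (by simp [hU]), ?_⟩
  rw [hXU]
  exact (hexp.const_mul U).mul_const (star U)

section Critical

variable {n : ℕ} {A : Matrix (Fin n) (Fin n) ℂ} (hA : A.trace = 0)

include hA

theorem isCriticalPoint_iff : IsCriticalPoint A ↔ 0 < gramDet A ∧ critGrad A = 0 := by
  constructor
  · rintro ⟨⟨-, hZ⟩, h⟩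
    have hD := (notMem_Z_iff hA).mp hZ
    obtain ⟨g, hg0, hg⟩ :=
      exists_specialLinearGroup_hasDerivAt (conjTranspose_critGrad A) (trace_critGrad A)
    have hderiv := (hasDerivAt_K_Ad hg0 hg hD.ne').unique
      (h g hg0 (differentiableAt_matrix.mp hg.differentiableAt))
    have hsq : (critGrad A * critGrad A).trace.re = normSq (critGrad A) := by
      rw [normSq, conjTranspose_critGrad]
    rw [hsq, mul_eq_zero, or_iff_right (by positivity), normSq_eq_zero] at hderiv
    exact ⟨hD, hderiv⟩
  · rintro ⟨hD, h⟩
    refine ⟨⟨mem_orbit_self A, (notMem_Z_iff hA).mpr hD⟩, fun g hg0 hg => ?_⟩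
    simpa [h] using hasDerivAt_K_Ad hg0 (differentiableAt_matrix.mpr hg).hasDerivAt hD.ne'

theorem AttainsMin.isCriticalPoint (h : AttainsMin A) : IsCriticalPoint A := by
  obtain ⟨hmem, hmin⟩ := h
  have hD := (notMem_Z_iff hA).mp hmem.2
  refine ⟨hmem, fun g hg0 hg => ?_⟩
  have hg' := (differentiableAt_matrix.mpr hg).hasDerivAt
  have hK := hasDerivAt_K_Ad hg0 hg' hD.ne'
  have hpos : ∀ᶠ t in nhds (0 : ℝ), 0 < gramDet (Ad (g t) A) :=
    (hasDerivAt_gramDet_Ad hg0 hg').continuousAt.eventually_const_lt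
      (by simpa only [hg0, Ad_one] using hD)
  have hloc : IsLocalMin (fun t => K (Ad (g t) A)) 0 := by
    filter_upwards [hpos] with t ht
    rw [hg0, Ad_one]
    exact hmin ⟨⟨g t, rfl⟩, (notMem_Z_iff (by rw [trace_Ad, hA])).mpr ht⟩
  exact hK.congr_deriv (hloc.hasDerivAt_eq_zero hK)

end Critical

end OrbitCalculus

/-! ### Orbits and unitary conjugation -/

section Orbit

variable {n : ℕ} {A B : Matrix (Fin n) (Fin n) ℂ}

theorem orbit_eq_of_mem (h : B ∈ orbit A) : orbit B = orbit A := by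
  obtain ⟨g, rfl⟩ := h
  ext C
  constructor
  · rintro ⟨h, rfl⟩
    exact ⟨h * g, Ad_Ad h A g⟩
  · rintro ⟨h, rfl⟩
    exact ⟨h * g⁻¹, by rw [Ad_Ad, inv_mul_cancel_right]⟩

theorem mem_orbit_symm (h : B ∈ orbit A) : A ∈ orbit B :=
  orbit_eq_of_mem h ▸ mem_orbit_self A

theorem trace_eq_of_mem_orbit (h : B ∈ orbit A) : B.trace = A.trace := by
  obtain ⟨g, rfl⟩ := h
  exact trace_Ad g A

theorem isNilpotent_of_mem_orbit (h : B ∈ orbit A) (hA : IsNilpotent A) : IsNilpotent B := by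
  obtain ⟨g, rfl⟩ := h
  obtain ⟨k, hk⟩ := hA
  exact ⟨k, by rw [← Ad_pow, hk, Ad, Matrix.mul_zero, Matrix.zero_mul]⟩

theorem smul_mem_orbit (c : ℂ) (h : B ∈ orbit A) : c • B ∈ orbit (c • A) := by
  obtain ⟨g, rfl⟩ := h
  exact ⟨g, by rw [Ad, Ad, Matrix.mul_smul, Matrix.smul_mul]⟩

theorem mul_mul_mem_orbit {P Q : Matrix (Fin n) (Fin n) ℂ} (hPQ : P * Q = 1)
    (A : Matrix (Fin n) (Fin n) ℂ) : P * A * Q ∈ orbit A := by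
  rcases Nat.eq_zero_or_pos n with rfl | hn
  · rw [Subsingleton.elim (P * A * Q) A]
    exact mem_orbit_self A
  have hdet : P.det ≠ 0 := fun h0 => by simpa [h0] using congrArg det hPQ
  obtain ⟨c, hc⟩ := IsAlgClosed.exists_pow_nat_eq (P.det)⁻¹ hn
  have hc0 : c ≠ 0 := by
    rintro rfl
    exact inv_ne_zero hdet (by rw [← hc, zero_pow hn.ne'])
  let g : SpecialLinearGroup (Fin n) ℂ :=
    ⟨c • P, by rw [det_smul, Fintype.card_fin, hc, inv_mul_cancel₀ hdet]⟩
  have hinv : (g⁻¹ : SpecialLinearGroup (Fin n) ℂ).1 = c⁻¹ • Q :=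
    left_inv_eq_right_inv (coe_inv_mul_coe g)
      (by rw [smul_mul_smul_comm, mul_inv_cancel₀ hc0, one_smul, hPQ])
  refine ⟨g, ?_⟩
  rw [Ad, hinv, show g.1 = c • P from rfl, Matrix.smul_mul, smul_mul_smul_comm,
    mul_inv_cancel₀ hc0, one_smul]

theorem attainsMin_iff (hA : A.trace = 0) :
    AttainsMin A ↔ 0 < gramDet A ∧ ∀ C ∈ orbit A, 0 < gramDet C → K A ≤ K C := by
  have hZ {C} (hC : C ∈ orbit A) : C ∉ Z n ↔ 0 < gramDet C :=
    notMem_Z_iff ((trace_eq_of_mem_orbit hC).trans hA)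
  constructor
  · rintro ⟨⟨hmem, hAZ⟩, hmin⟩
    exact ⟨(hZ hmem).mp hAZ, fun C hC hD => hmin ⟨hC, (hZ hC).mpr hD⟩⟩
  · rintro ⟨hD, hmin⟩
    exact ⟨⟨mem_orbit_self A, (hZ (mem_orbit_self A)).mpr hD⟩,
      fun C hC => hmin C hC.1 ((hZ hC.1).mp hC.2)⟩

end Orbit

section UnitaryInvariance

variable {n : ℕ} {U : Matrix (Fin n) (Fin n) ℂ} (hU : U ∈ unitaryGroup (Fin n) ℂ)

include hU

theorem unitary_conj_mem_orbit (B : Matrix (Fin n) (Fin n) ℂ) : U * B * Uᴴ ∈ orbit B :=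
  mul_mul_mem_orbit (mem_unitaryGroup_iff.mp hU) B

theorem normSq_unitary_conj (X : Matrix (Fin n) (Fin n) ℂ) : normSq (U * X * Uᴴ) = normSq X := by
  rw [normSq, normSq, conjTranspose_unitary_conj, unitary_conj_mul hU, trace_unitary_conj hU]

theorem gramDet_unitary_conj (X : Matrix (Fin n) (Fin n) ℂ) :
    gramDet (U * X * Uᴴ) = gramDet X := by
  rw [gramDet, gramDet, sq (U * X * Uᴴ), unitary_conj_mul hU, trace_unitary_conj hU,
    normSq_unitary_conj hU, sq X]

theorem K_unitary_conj (X : Matrix (Fin n) (Fin n) ℂ) : K (U * X * Uᴴ) = K X := by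
  rw [K_eq_div_gramDet, K_eq_div_gramDet, gramDet_unitary_conj hU, conjTranspose_unitary_conj,
    lie_unitary_conj hU, normSq_unitary_conj hU]

theorem attainsMin_unitary_conj {B : Matrix (Fin n) (Fin n) ℂ} (hB : B.trace = 0) :
    AttainsMin (U * B * Uᴴ) ↔ AttainsMin B := by
  rw [attainsMin_iff hB, attainsMin_iff ((trace_unitary_conj hU B).trans hB),
    gramDet_unitary_conj hU, K_unitary_conj hU, orbit_eq_of_mem (unitary_conj_mem_orbit hU B)]

end UnitaryInvariance

/-! ### Gradings by real weights -/

/-- The matrix `X` has degree at least `d` for the grading in which the matrix unit at `(i, j)` has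
degree `h i - h j`. For strictly decreasing weights `h` this means upper triangular
if `d = 0`, and strictly upper triangular if `d > 0`. -/
def HasDeg {ι R : Type*} [Zero R] (h : ι → ℝ) (d : ℝ) (X : Matrix ι ι R) : Prop :=
  ∀ i j, h i - h j < d → X i j = 0

namespace HasDeg

variable {ι R : Type*} {h : ι → ℝ} {d d' : ℝ}

theorem smul [MulZeroClass R] {X : Matrix ι ι R} (c : R) (hX : HasDeg h d X) :
    HasDeg h d (c • X) := fun i j hij => by
  rw [Matrix.smul_apply, hX i j hij, smul_zero]

variable [Fintype ι]

theorem trace_eq_zero [AddCommMonoid R] {X : Matrix ι ι R} (hX : HasDeg h d X) (hd : 0 < d) :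
    X.trace = 0 :=
  Finset.sum_eq_zero fun i _ => hX i i (by linarith)

theorem mul [NonUnitalNonAssocSemiring R] {X Y : Matrix ι ι R} (hX : HasDeg h d X)
    (hY : HasDeg h d' Y) : HasDeg h (d + d') (X * Y) := by
  intro i j hij
  rw [mul_apply]
  refine Finset.sum_eq_zero fun k _ => ?_
  by_cases hk : h i - h k < d
  · rw [hX i k hk, zero_mul]
  · rw [hY k j (by linarith), mul_zero]

variable [DecidableEq ι]

theorem pow [Semiring R] {X : Matrix ι ι R} (hX : HasDeg h d X) (k : ℕ) :
    HasDeg h (k * d) (X ^ k) := by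
  induction k with
  | zero =>
    intro i j hij
    have hne : i ≠ j := by
      rintro rfl
      simp at hij
    rw [pow_zero, Matrix.one_apply_ne hne]
  | succ k ih =>
    rw [pow_succ, Nat.cast_succ, add_one_mul]
    exact ih.mul hX

theorem isNilpotent [Semiring R] {X : Matrix ι ι R} (hX : HasDeg h d X) (hd : 0 < d) :
    IsNilpotent X := by
  obtain ⟨C, hC⟩ := (Set.finite_range fun p : ι × ι => h p.1 - h p.2).bddAbove
  obtain ⟨k, hk⟩ := exists_nat_gt (C / d)
  refine ⟨k, ?_⟩
  ext i j
  exact hX.pow k i j ((hC ⟨(i, j), rfl⟩).trans_lt (by rwa [div_lt_iff₀ hd] at hk))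

theorem of_mul_eq_one [CommRing R] {T S : Matrix ι ι R} (hT : HasDeg h 0 T) (hTS : T * S = 1) :
    HasDeg h 0 S := by
  have hT' : BlockTriangular T (-h) := fun i j hij => hT i j (by simpa using hij)
  let _ := invertibleOfRightInverse _ _ hTS
  have hS := blockTriangular_inv_of_blockTriangular hT'
  rw [inv_eq_right_inv hTS] at hS
  exact fun i j hij => hS (by simpa using hij)

end HasDeg

section ComplexWeights

variable {n : ℕ} {h : Fin n → ℝ}

theorem HasDeg.le_trace_lie {d : ℝ} {X : Matrix (Fin n) (Fin n) ℂ} (hX : HasDeg h d X) :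
    d * normSq X ≤ (⁅diagonal fun i => (h i : ℂ), X⁆ * Xᴴ).trace.re := by
  rw [normSq_eq_sum, trace, Complex.re_sum, Finset.mul_sum]
  refine Finset.sum_le_sum fun i _ => ?_
  rw [diag_apply, mul_apply, Complex.re_sum, Finset.mul_sum]
  refine Finset.sum_le_sum fun j _ => ?_
  rw [lie_diagonal_apply, conjTranspose_apply, mul_assoc, RCLike.star_def, Complex.mul_conj,
    Complex.normSq_eq_norm_sq, ← Complex.ofReal_sub, ← Complex.ofReal_mul, Complex.ofReal_re]
  by_cases hij : h i - h j < d
  · simp [hX i j hij]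
  · exact mul_le_mul_of_nonneg_right (not_lt.mp hij) (sq_nonneg _)

theorem exists_unitary_conjTranspose_mul_hasDeg_zero (h : Fin n → ℝ)
    (P : Matrix (Fin n) (Fin n) ℂ) : ∃ U ∈ unitaryGroup (Fin n) ℂ, HasDeg h 0 (Uᴴ * P) := by
  -- Gram-Schmidt applied to the columns of `P`, taken in the order of decreasing weight.
  let σ := Tuple.sort (-h)
  let f : Fin n → EuclideanSpace ℂ (Fin n) := fun j => WithLp.toLp 2 fun a => P a (σ j)
  let b := InnerProductSpace.gramSchmidtOrthonormalBasis (𝕜 := ℂ) (by simp) f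
  let U : Matrix (Fin n) (Fin n) ℂ := of fun a j => b (σ.symm j) a
  refine ⟨U, ?_, fun i j hij => ?_⟩
  · convert (EuclideanSpace.basisFun (Fin n) ℂ).toMatrix_orthonormalBasis_mem_unitary (b.reindex σ)
      using 1
    ext a j
    simp [U, Module.Basis.toMatrix_apply]
  · have hinner : (Uᴴ * P) i j = inner ℂ (b (σ.symm i)) (f (σ.symm j)) := by
      simp [mul_apply, U, f, PiLp.inner_apply, mul_comm]
    rw [hinner]
    refine InnerProductSpace.gramSchmidtOrthonormalBasis_inv_triangular _ _ ?_
    by_contra! hle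
    have hmono := Tuple.monotone_sort (-h) hle
    simp only [Function.comp_apply, σ, Equiv.apply_symm_apply, Pi.neg_apply] at hmono
    linarith

/-- The Iwasawa decomposition. -/
theorem exists_unitary_mul_hasDeg_zero {P Q : Matrix (Fin n) (Fin n) ℂ} (hPQ : P * Q = 1)
    (h : Fin n → ℝ) : ∃ U ∈ unitaryGroup (Fin n) ℂ, ∃ T S : Matrix (Fin n) (Fin n) ℂ,
      T * S = 1 ∧ HasDeg h 0 T ∧ HasDeg h 0 S ∧ P = U * T ∧ Q = S * Uᴴ := by
  obtain ⟨U, hU, hT⟩ := exists_unitary_conjTranspose_mul_hasDeg_zero h P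
  have hUU : Uᴴ * U = 1 := mem_unitaryGroup_iff'.mp hU
  have hUU' : U * Uᴴ = 1 := mem_unitaryGroup_iff.mp hU
  have hTS : (Uᴴ * P) * (Q * U) = 1 := by
    rw [Matrix.mul_assoc, ← Matrix.mul_assoc P, hPQ, Matrix.one_mul, hUU]
  refine ⟨U, hU, Uᴴ * P, Q * U, hTS, hT, hT.of_mul_eq_one hTS, ?_, ?_⟩
  · rw [← Matrix.mul_assoc, hUU', Matrix.one_mul]
  · rw [Matrix.mul_assoc, hUU', Matrix.mul_one]

end ComplexWeights

/-! ### Lower bounds for the norm of the commutator -/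

section Bessel

variable {n : ℕ}

theorem sq_re_trace_mul_conjTranspose_le (A B : Matrix (Fin n) (Fin n) ℂ) :
    (A * Bᴴ).trace.re ^ 2 ≤ normSq A * normSq B := by
  obtain rfl | hB := eq_or_ne B 0
  · simp [normSq]
  have hB' := normSq_pos.mpr hB
  set x := (A * Bᴴ).trace.re
  have h := normSq_nonneg (A - ((x / normSq B : ℝ) : ℂ) • B)
  rw [normSq_sub_smul, RCLike.star_def, Complex.conj_ofReal, Complex.re_ofReal_mul,
    Complex.norm_real, Real.norm_eq_abs, sq_abs] at h
  have hx : x ^ 2 / normSq B ≤ normSq A := by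
    have : (x / normSq B) ^ 2 * normSq B = x ^ 2 / normSq B := by field_simp
    have : x / normSq B * x = x ^ 2 / normSq B := by ring
    linarith
  rwa [div_le_iff₀ hB'] at hx

theorem bessel_of_re_trace_eq_zero {A B C : Matrix (Fin n) (Fin n) ℂ}
    (h : (B * Cᴴ).trace.re = 0) :
    (A * Bᴴ).trace.re ^ 2 * normSq C + (A * Cᴴ).trace.re ^ 2 * normSq B ≤
      normSq A * (normSq B * normSq C) := by
  set x := (A * Bᴴ).trace.re
  set y := (A * Cᴴ).trace.re
  set t := x ^ 2 * normSq C + y ^ 2 * normSq B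
  have hB := normSq_nonneg B
  have hC := normSq_nonneg C
  set V := ((x * normSq C : ℝ) : ℂ) • B + ((y * normSq B : ℝ) : ℂ) • C with hV
  have hAV : (A * Vᴴ).trace.re = t := by
    simp only [hV, conjTranspose_add, conjTranspose_smul, Matrix.mul_add, Matrix.mul_smul,
      trace_add, trace_smul, smul_eq_mul, RCLike.star_def, Complex.conj_ofReal, Complex.add_re,
      Complex.re_ofReal_mul]
    ring
  have hVV : normSq V = normSq B * normSq C * t := by
    rw [hV, normSq_add, normSq_smul, normSq_smul, Matrix.smul_mul, conjTranspose_smul,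
      Matrix.mul_smul, trace_smul, trace_smul, smul_eq_mul, smul_eq_mul, RCLike.star_def,
      Complex.conj_ofReal, Complex.re_ofReal_mul, Complex.re_ofReal_mul, h]
    simp only [Complex.norm_real, Real.norm_eq_abs, sq_abs]
    ring
  have hCS := sq_re_trace_mul_conjTranspose_le A V
  rw [hAV, hVV] at hCS
  have hA := normSq_nonneg A
  have ht0 : 0 ≤ t := by positivity
  obtain ht0 | ht0 := ht0.eq_or_lt
  · rw [← ht0]
    positivity
  · exact le_of_mul_le_mul_right (by linarith) ht0

end Bessel

theorem conjTranspose_diagonal_ofReal {ι : Type*} [DecidableEq ι] (h : ι → ℝ) :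
    (diagonal fun i => (h i : ℂ))ᴴ = diagonal fun i => (h i : ℂ) := by
  rw [diagonal_conjTranspose]
  congr 1
  ext i
  simp

theorem trace_lie_add_mul_of_conjTranspose_eq {ι R : Type*} [Fintype ι] [CommRing R] [StarRing R]
    {D : Matrix ι ι R} (hD : Dᴴ = D) (N : Matrix ι ι R) :
    (⁅D + N, (D + N)ᴴ⁆ * D).trace = (⁅D, N⁆ * Nᴴ).trace := by
  classical
  rw [trace_mul_comm, ← trace_lie_mul, lie_add, lie_self, zero_add, conjTranspose_add, hD,
    Matrix.mul_add, trace_add, trace_lie_mul_left_self, zero_add]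

namespace HasDeg

theorem trace_diagonal_mul {ι R : Type*} [Fintype ι] [DecidableEq ι] [NonUnitalNonAssocSemiring R]
    {h : ι → ℝ} {d : ℝ} {N : Matrix ι ι R} (hN : HasDeg h d N) (hd : 0 < d) (v : ι → R) :
    (diagonal v * N).trace = 0 :=
  Finset.sum_eq_zero fun i _ => by
    rw [diag_apply, diagonal_mul, hN i i (by linarith), mul_zero]

variable {n : ℕ} {h : Fin n → ℝ} {d : ℝ} {N : Matrix (Fin n) (Fin n) ℂ}

theorem sq_mul_normSq_sq_le (hN : HasDeg h d N) (hd : 0 ≤ d) :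
    d ^ 2 * normSq N ^ 2 ≤ normSq (diagonal fun i => (h i : ℂ)) * normSq ⁅N, Nᴴ⁆ := by
  have hle := hN.le_trace_lie
  rw [trace_lie_mul, ← conjTranspose_lie_conjTranspose_self] at hle
  have hN0 := normSq_nonneg N
  calc d ^ 2 * normSq N ^ 2 = (d * normSq N) ^ 2 := by ring
    _ ≤ _ := pow_le_pow_left₀ (by positivity) hle 2
    _ ≤ _ := sq_re_trace_mul_conjTranspose_le _ _

section PosDegree

variable (hN : HasDeg h d N) (hd : 0 < d)

include hN hd

theorem trace_diagonal_mul_conjTranspose :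
    ((diagonal fun i => (h i : ℂ)) * Nᴴ).trace = 0 := by
  rw [← star_trace_mul_conjTranspose, conjTranspose_diagonal_ofReal, trace_mul_comm,
    hN.trace_diagonal_mul hd, star_zero]

theorem trace_mul_self : (N * N).trace = 0 :=
  (hN.mul hN).trace_eq_zero (by linarith)

theorem normSq_diagonal_add :
    normSq (diagonal (fun i => (h i : ℂ)) + N) =
      normSq (diagonal fun i => (h i : ℂ)) + normSq N := by
  rw [normSq_add, hN.trace_diagonal_mul_conjTranspose hd, Complex.zero_re, mul_zero, add_zero]

theorem normSq_add_conjTranspose : normSq (N + Nᴴ) = 2 * normSq N := by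
  rw [normSq_add, normSq_conjTranspose, conjTranspose_conjTranspose, hN.trace_mul_self hd,
    Complex.zero_re]
  ring

theorem gramDet_diagonal_add :
    gramDet (diagonal (fun i => (h i : ℂ)) + N) =
      normSq N * (2 * normSq (diagonal fun i => (h i : ℂ)) + normSq N) := by
  have hsq : ((diagonal (fun i => (h i : ℂ)) + N) ^ 2).trace =
      normSq (diagonal fun i => (h i : ℂ)) := by
    rw [sq, Matrix.add_mul, Matrix.mul_add, Matrix.mul_add, trace_add, trace_add, trace_add,
      trace_mul_comm N, hN.trace_diagonal_mul hd, hN.trace_mul_self hd, ofReal_normSq,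
      conjTranspose_diagonal_ofReal]
    ring
  rw [gramDet, hN.normSq_diagonal_add hd, hsq, Complex.norm_real, Real.norm_eq_abs, sq_abs]
  ring

end PosDegree

theorem sq_mul_gramDet_diagonal_add_le (hN : HasDeg h d N) (hd : 0 < d) :
    d ^ 2 * gramDet (diagonal (fun i => (h i : ℂ)) + N) ≤
      normSq (diagonal fun i => (h i : ℂ)) *
        normSq ⁅diagonal (fun i => (h i : ℂ)) + N, (diagonal (fun i => (h i : ℂ)) + N)ᴴ⁆ := by
  rw [hN.gramDet_diagonal_add hd]
  set D : Matrix (Fin n) (Fin n) ℂ := diagonal fun i => (h i : ℂ)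
  have hDs : Dᴴ = D := conjTranspose_diagonal_ofReal h
  set μ := ⁅D + N, (D + N)ᴴ⁆ with hμ
  have hμs : μᴴ = μ := conjTranspose_lie_conjTranspose_self _
  set q := (⁅D, N⁆ * Nᴴ).trace.re
  have hμD : (μ * Dᴴ).trace.re = q := by
    rw [hDs, hμ, trace_lie_add_mul_of_conjTranspose_eq hDs]
  have hμN : (μ * N).trace.re = -q := by
    have h0 := congrArg Complex.re (trace_lie_mul_left_self (D + N) (D + N)ᴴ)
    rw [← hμ, Matrix.mul_add, trace_add, Complex.add_re, ← hDs, hμD, Complex.zero_re] at h0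
    linarith
  have hμN' : (μ * (N + Nᴴ)ᴴ).trace.re = -(2 * q) := by
    have hμN'' : (μ * Nᴴ).trace.re = -q := by
      rw [re_trace_mul_conjTranspose_comm, hμs, trace_mul_comm, hμN]
    rw [conjTranspose_add, conjTranspose_conjTranspose, Matrix.mul_add, trace_add, Complex.add_re,
      hμN, hμN'']
    ring
  have hDN : (D * (N + Nᴴ)ᴴ).trace.re = 0 := by
    rw [conjTranspose_add, conjTranspose_conjTranspose, Matrix.mul_add, trace_add,
      hN.trace_diagonal_mul_conjTranspose hd, hN.trace_diagonal_mul hd, add_zero, Complex.zero_re]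
  have hB := bessel_of_re_trace_eq_zero (A := μ) hDN
  rw [hμD, hμN', hN.normSq_add_conjTranspose hd] at hB
  have hle : d * normSq N ≤ q := hN.le_trace_lie
  obtain hN0 | hN0 := (normSq_nonneg N).eq_or_lt
  · rw [← hN0, zero_mul, mul_zero]
    exact mul_nonneg (normSq_nonneg D) (normSq_nonneg μ)
  have hD0 := normSq_nonneg D
  have hsq : (d * normSq N) ^ 2 ≤ q ^ 2 := pow_le_pow_left₀ (by positivity) hle 2
  refine le_of_mul_le_mul_left ?_ hN0
  have := mul_le_mul_of_nonneg_right hsq (by positivity : 0 ≤ 2 * normSq D + normSq N)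
  linarith

end HasDeg

/-! ### Nilpotent elements of `sl(2)` -/

section Exponential

variable {R : Type*} [Ring R] [Algebra ℚ R] {a y : R}

open LieAlgebra in
theorem exp_mul_eq_exp_ad_mul (ha : IsNilpotent a) (y : R) :
    IsNilpotent.exp a * y = IsNilpotent.exp (ad ℚ R a) y * IsNilpotent.exp a := by
  have hR : IsNilpotent (LinearMap.mulRight ℚ a) := (LinearMap.isNilpotent_mulRight_iff ℚ a).mpr ha
  have hL : LinearMap.mulLeft ℚ a = LinearMap.mulRight ℚ a + ad ℚ R a := by
    rw [congrFun (ad_eq_lmul_left_sub_lmul_right (R := ℚ) R) a, Pi.sub_apply, add_sub_cancel]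
  have hcomm : Commute (LinearMap.mulRight ℚ a) (ad ℚ R a) := by
    rw [congrFun (ad_eq_lmul_left_sub_lmul_right (R := ℚ) R) a, Pi.sub_apply]
    exact (LinearMap.commute_mulLeft_right a a).symm.sub_right (Commute.refl _)
  have hexpL : IsNilpotent.exp (LinearMap.mulLeft ℚ a) y = IsNilpotent.exp a * y :=
    (LinearMap.congr_fun (IsNilpotent.map_exp ha (Algebra.lmul ℚ R)) y).symm
  have hexpR (z : R) : IsNilpotent.exp (LinearMap.mulRight ℚ a) z = z * IsNilpotent.exp a := by
    obtain ⟨k, hk⟩ := ha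
    have hk' : LinearMap.mulRight ℚ a ^ k = 0 := by
      rw [LinearMap.pow_mulRight, hk, LinearMap.mulRight_zero_eq_zero]
    simp only [IsNilpotent.exp_eq_sum hk, IsNilpotent.exp_eq_sum hk', LinearMap.sum_apply,
      LinearMap.smul_apply, LinearMap.pow_mulRight, LinearMap.mulRight_apply, Finset.mul_sum,
      mul_smul_comm]
  rw [← hexpL, hL, IsNilpotent.exp_add_of_commute hcomm hR (ad_nilpotent_of_nilpotent ha),
    Module.End.mul_apply, hexpR]

theorem exp_mul_of_lie_lie_lie_eq_zero (ha : IsNilpotent a) (h : ⁅a, ⁅a, ⁅a, y⁆⁆⁆ = 0) :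
    IsNilpotent.exp a * y = (y + ⁅a, y⁆ + (2⁻¹ : ℚ) • ⁅a, ⁅a, y⁆⁆) * IsNilpotent.exp a := by
  have hexp : IsNilpotent.exp (LieAlgebra.ad ℚ R a) y = y + ⁅a, y⁆ + (2⁻¹ : ℚ) • ⁅a, ⁅a, y⁆⁆ :=
    (IsNilpotent.exp_smul_eq_sum (k := 3) h (LieAlgebra.ad_nilpotent_of_nilpotent ha)).trans <| by
      simp [Finset.sum_range_succ, pow_succ]
  rw [exp_mul_eq_exp_ad_mul ha, hexp]

end Exponential

theorem isNilpotent_conjTranspose {ι R : Type*} [Fintype ι] [DecidableEq ι] [Semiring R]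
    [StarRing R] {A : Matrix ι ι R} (hA : IsNilpotent A) : IsNilpotent Aᴴ := by
  obtain ⟨k, hk⟩ := hA
  exact ⟨k, by rw [← conjTranspose_pow, hk, conjTranspose_zero]⟩

namespace IsRaising

variable {n : ℕ} {E : Matrix (Fin n) (Fin n) ℂ}

theorem sl2Comb_mem_orbit_of_isNilpotent (h : IsRaising E) (hE : IsNilpotent E) (a b c s : ℂ) :
    sl2Comb E (a + s * c) (b - 2 * s * a - s ^ 2 * c) c ∈ orbit (sl2Comb E a b c) := by
  have hnil : IsNilpotent (s • E) := hE.smul s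
  have hsE : s • E = sl2Comb E 0 s 0 := by simp [sl2Comb]
  have h1 : ⁅s • E, sl2Comb E a b c⁆ = sl2Comb E (s * c) (-(2 * s * a)) 0 := by
    rw [hsE, h.lie_sl2Comb]; congr 1 <;> ring
  have h2 : ⁅s • E, ⁅s • E, sl2Comb E a b c⁆⁆ = sl2Comb E 0 (-(2 * s ^ 2 * c)) 0 := by
    rw [h1, hsE, h.lie_sl2Comb]; congr 1 <;> ring
  have h3 : ⁅s • E, ⁅s • E, ⁅s • E, sl2Comb E a b c⁆⁆⁆ = 0 := by
    rw [h2, hsE, h.lie_sl2Comb]; simp [sl2Comb]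
  have hsum : sl2Comb E a b c + ⁅s • E, sl2Comb E a b c⁆ +
      (2⁻¹ : ℚ) • ⁅s • E, ⁅s • E, sl2Comb E a b c⁆⁆ =
      sl2Comb E (a + s * c) (b - 2 * s * a - s ^ 2 * c) c := by
    rw [h2, h1, ← Rat.cast_smul_eq_qsmul ℂ, Rat.cast_inv, Rat.cast_ofNat]
    simp only [sl2Comb]
    module
  rw [← hsum]
  convert mul_mul_mem_orbit (IsNilpotent.exp_mul_exp_neg_self hnil) (sl2Comb E a b c) using 1
  rw [exp_mul_of_lie_lie_lie_eq_zero hnil h3, Matrix.mul_assoc,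
    IsNilpotent.exp_mul_exp_neg_self hnil, Matrix.mul_one]

theorem smul_lie_mem_orbit_of_isNilpotent (h : IsRaising E) (hE : IsNilpotent E) {a : ℂ}
    (ha : a ≠ 0) (b : ℂ) : a • ⁅E, Eᴴ⁆ ∈ orbit (sl2Comb E a b 0) := by
  convert h.sl2Comb_mem_orbit_of_isNilpotent hE a b 0 (b / (2 * a)) using 1
  rw [show b - 2 * (b / (2 * a)) * a - (b / (2 * a)) ^ 2 * 0 = 0 by field_simp; ring]
  simp [sl2Comb]

theorem exists_smul_lie_mem_orbit (h : IsRaising E) (hE : IsNilpotent E) {a b c : ℂ}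
    (habc : a ^ 2 + b * c ≠ 0) :
    ∃ r : ℂ, r ≠ 0 ∧ r • ⁅E, Eᴴ⁆ ∈ orbit (sl2Comb E a b c) := by
  obtain rfl | hc := eq_or_ne c 0
  · have ha : a ≠ 0 := by simpa using habc
    exact ⟨a, ha, h.smul_lie_mem_orbit_of_isNilpotent hE ha b⟩
  obtain ⟨r, hr⟩ := IsAlgClosed.exists_pow_nat_eq (a ^ 2 + b * c) two_pos
  have hr0 : r ≠ 0 := by
    rintro rfl
    exact habc (by rw [← hr, zero_pow two_ne_zero])
  have hlower : sl2Comb E r 0 c ∈ orbit (sl2Comb E a b c) := by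
    convert h.sl2Comb_mem_orbit_of_isNilpotent hE a b c ((r - a) / c) using 2
    · field_simp
      ring
    · field_simp
      linear_combination hr
  refine ⟨r, hr0, ?_⟩
  have hdiag := h.conjTranspose.smul_lie_mem_orbit_of_isNilpotent
    (isNilpotent_conjTranspose hE) (neg_ne_zero.mpr hr0) c
  rwa [sl2Comb_conjTranspose, neg_neg, orbit_eq_of_mem hlower, conjTranspose_conjTranspose,
    ← lie_skew, neg_smul_neg] at hdiag

theorem exists_smul_mem_orbit (h : IsRaising E) (hE : IsNilpotent E) {a b c : ℂ}
    (habc : a ^ 2 + b * c = 0) : ∃ r : ℂ, r • E ∈ orbit (sl2Comb E a b c) := by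
  obtain rfl | hc := eq_or_ne c 0
  · obtain rfl : a = 0 := by simpa using habc
    refine ⟨b, ?_⟩
    convert mem_orbit_self (sl2Comb E 0 b 0) using 1
    simp [sl2Comb]
  have hlower : sl2Comb E c (-c) c ∈ orbit (sl2Comb E a b c) := by
    convert h.sl2Comb_mem_orbit_of_isNilpotent hE a b c ((c - a) / c) using 2
    · field_simp
      ring
    · field_simp
      linear_combination -habc
  refine ⟨-c, ?_⟩
  have hraise := h.conjTranspose.sl2Comb_mem_orbit_of_isNilpotent
    (isNilpotent_conjTranspose hE) (-c) c (-c) (-1)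
  rw [sl2Comb_conjTranspose, sl2Comb_conjTranspose, neg_neg, orbit_eq_of_mem hlower] at hraise
  convert hraise using 1
  simp only [sl2Comb]
  module

theorem isNilpotent_sl2Comb_iff (h : IsRaising E) (hE0 : E ≠ 0) (hE : IsNilpotent E) {a b c : ℂ} :
    IsNilpotent (sl2Comb E a b c) ↔ a ^ 2 + b * c = 0 := by
  refine ⟨fun hnil => ?_, fun habc => ?_⟩
  · have htr := (isNilpotent_trace_of_isNilpotent (hnil.pow_of_pos two_ne_zero)).eq_zero
    rw [h.trace_sl2Comb_sq] at htr
    have hE' : (normSq E : ℂ) ≠ 0 := Complex.ofReal_ne_zero.mpr (normSq_pos.mpr hE0).ne'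
    simpa [hE'] using htr
  · obtain ⟨r, hr⟩ := h.exists_smul_mem_orbit hE habc
    exact isNilpotent_of_mem_orbit (mem_orbit_symm hr) (hE.smul r)

end IsRaising

section CriticalPoints

variable {n : ℕ} {A : Matrix (Fin n) (Fin n) ℂ}

theorem finrank_genAlg_le_one {c : ℂ} (h : c • Aᴴ = A) : Module.finrank ℂ (genAlg A) ≤ 1 := by
  have hspan : genAlg A ≤ LieSubalgebra.lieSpan ℂ _ {Aᴴ} := by
    have hAs : Aᴴ ∈ LieSubalgebra.lieSpan ℂ _ {Aᴴ} := LieSubalgebra.subset_lieSpan rfl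
    have hA : A ∈ LieSubalgebra.lieSpan ℂ _ {Aᴴ} := by
      simpa only [h] using LieSubalgebra.smul_mem _ c hAs
    rw [genAlg, LieSubalgebra.lieSpan_le]
    rintro X (rfl | rfl | rfl)
    exacts [hA, hAs, LieSubalgebra.lie_mem _ hA hAs]
  have hcoe : (LieSubalgebra.lieSpan ℂ _ {Aᴴ}).toSubmodule = Submodule.span ℂ {Aᴴ} :=
    LieSubalgebra.coe_lieSpan_eq_span_of_forall_lie_eq_zero (by simp)
  calc Module.finrank ℂ (genAlg A) ≤ Module.finrank ℂ (Submodule.span ℂ {Aᴴ}) :=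
        Submodule.finrank_mono (hcoe ▸ hspan)
    _ ≤ 1 := (finrank_span_le_card _).trans (by simp)

theorem gramDet_pos_of_one_lt_finrank_genAlg (hA : A ≠ 0)
    (h : 1 < Module.finrank ℂ (genAlg A)) : 0 < gramDet A := by
  refine (gramDet_nonneg A).lt_of_ne' fun h0 => ?_
  rw [← normSq_mul_normSq_sub_adjointCoeff_smul, mul_eq_zero,
    or_iff_right (normSq_pos.mpr hA).ne', normSq_eq_zero, sub_eq_zero] at h0
  exact h.not_ge (finrank_genAlg_le_one h0.symm)

theorem IsRaising.isSUConjToStd {E : Matrix (Fin n) (Fin n) ℂ} (hE : IsRaising E) (hE0 : E ≠ 0) :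
    IsSUConjToStd hE.toLieSubalgebra := by
  obtain ⟨U, hU, π, hconj⟩ := hE.exists_specialUnitary_conj_stdE hE0
  refine ⟨U, hU, π, ?_⟩
  ext B
  constructor
  · rintro ⟨a, b, c, rfl⟩
    exact ⟨_, mem_stdSl2_iff.mpr ⟨a, b, c, rfl⟩, (hconj a b c).symm⟩
  · rintro ⟨_, hB, rfl⟩
    obtain ⟨a, b, c, rfl⟩ := mem_stdSl2_iff.mp hB
    exact ⟨a, b, c, hconj a b c⟩

theorem IsSUConjToStd.exists_suConjInto (h : IsSUConjToStd (genAlg A)) :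
    ∃ π : n.Partition, SUConjInto A (stdSl2 π) := by
  obtain ⟨U, hU, π, hπ⟩ := h
  have hmem : A ∈ (genAlg A : Set (Matrix (Fin n) (Fin n) ℂ)) :=
    LieSubalgebra.subset_lieSpan (by simp)
  rw [hπ] at hmem
  obtain ⟨B, hB, rfl⟩ := hmem
  exact ⟨π, U, hU, B, hB, rfl⟩

theorem trace_eq_zero_of_mem_stdSl2 {π : n.Partition} (hA : A ∈ stdSl2 π) : A.trace = 0 := by
  obtain ⟨a, b, c, rfl⟩ := mem_stdSl2_iff.mp hA
  exact (isRaising_stdE π).trace_sl2Comb a b c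

theorem SUConjInto.exists_isRaising {π : n.Partition} (h : SUConjInto A (stdSl2 π)) :
    ∃ E, ∃ hE : IsRaising E, A ∈ hE.toLieSubalgebra := by
  obtain ⟨U, hU, B, hB, rfl⟩ := h
  obtain ⟨a, b, c, rfl⟩ := mem_stdSl2_iff.mp hB
  have hU' := (mem_specialUnitaryGroup_iff.mp hU).1
  exact ⟨_, (isRaising_stdE π).unitary_conj hU', a, b, c, sl2Comb_unitary_conj hU' _ a b c⟩

theorem IsCriticalPoint.exists_isRaising (h : IsCriticalPoint A) (hA : A.trace = 0)
    (hW : ¬ ∃ B ∈ W n \ Z n, B ∈ orbit A) :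
    ∃ E, ∃ hE : IsRaising E, E ≠ 0 ∧ genAlg A = hE.toLieSubalgebra := by
  obtain ⟨hD, hgrad⟩ := (isCriticalPoint_iff hA).mp h
  exact exists_isRaising_of_critGrad_eq_zero hD
    (fun h0 => hW ⟨A, ⟨⟨hA, h0⟩, h.1.2⟩, mem_orbit_self A⟩) hgrad

theorem isCriticalPoint_iff_isSUConjToStd (hA0 : A ≠ 0) (hA : A.trace = 0)
    (hW : ¬ ∃ B ∈ W n \ Z n, B ∈ orbit A) :
    IsCriticalPoint A ↔ Module.finrank ℂ (genAlg A) = 3 ∧ IsSUConjToStd (genAlg A) := by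
  constructor
  · intro h
    obtain ⟨E, hE, hE0, hgen⟩ := h.exists_isRaising hA hW
    rw [hgen]
    exact ⟨hE.finrank_toLieSubalgebra hE0, hE.isSUConjToStd hE0⟩
  · rintro ⟨hrank, hstd⟩
    have hD : 0 < gramDet A := gramDet_pos_of_one_lt_finrank_genAlg hA0 (by lia)
    obtain ⟨π, hπ⟩ := hstd.exists_suConjInto
    obtain ⟨E, hE, hmem⟩ := hπ.exists_isRaising
    exact (isCriticalPoint_iff hA).mpr ⟨hD, hE.critGrad_eq_zero hmem hD⟩

end CriticalPoints

/-! ### Minima on orbits -/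

section OrbitBounds

variable {n : ℕ}

theorem sq_div_normSq_le_K {C D : Matrix (Fin n) (Fin n) ℂ} {d : ℝ} (hC : 0 < gramDet C)
    (h : d ^ 2 * gramDet C ≤ normSq D * normSq ⁅C, Cᴴ⁆) : d ^ 2 / normSq D ≤ K C := by
  rw [K_eq_div_gramDet]
  refine div_le_of_le_mul₀ (normSq_nonneg D) (div_nonneg (normSq_nonneg _) hC.le) ?_
  rw [div_mul_eq_mul_div, le_div_iff₀ hC]
  linarith

theorem exists_hasDeg_zero_unitary_conj_of_mem_orbit {C X : Matrix (Fin n) (Fin n) ℂ}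
    (hC : C ∈ orbit X) (h : Fin n → ℝ) :
    ∃ U ∈ unitaryGroup (Fin n) ℂ, ∃ T S : Matrix (Fin n) (Fin n) ℂ,
      T * S = 1 ∧ HasDeg h 0 T ∧ HasDeg h 0 S ∧ C = U * (T * X * S) * Uᴴ := by
  obtain ⟨g, rfl⟩ := hC
  obtain ⟨U, hU, T, S, hTS, hT, hS, hg, hg'⟩ := exists_unitary_mul_hasDeg_zero (coe_mul_coe_inv g) h
  refine ⟨U, hU, T, S, hTS, hT, hS, ?_⟩
  rw [Ad, hg, hg']
  simp only [Matrix.mul_assoc]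

theorem HasDeg.sq_div_normSq_diagonal_le_K {h : Fin n → ℝ} {d : ℝ}
    {C X : Matrix (Fin n) (Fin n) ℂ} (hX : HasDeg h d X) (hd : 0 ≤ d) (hC : C ∈ orbit X)
    (hD : 0 < gramDet C) : d ^ 2 / normSq (diagonal fun i => (h i : ℂ)) ≤ K C := by
  obtain ⟨U, hU, T, S, -, hT, hS, rfl⟩ := exists_hasDeg_zero_unitary_conj_of_mem_orbit hC h
  rw [gramDet_unitary_conj hU] at hD
  rw [K_unitary_conj hU]
  have hTXS : HasDeg h d (T * X * S) := by simpa only [zero_add, add_zero] using (hT.mul hX).mul hS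
  exact sq_div_normSq_le_K hD <|
    (mul_le_mul_of_nonneg_left (gramDet_le_normSq_sq _) (sq_nonneg d)).trans
      (hTXS.sq_mul_normSq_sq_le hd)

theorem hasDeg_lie_diagonal {h : Fin n → ℝ} {d : ℝ} {T : Matrix (Fin n) (Fin n) ℂ}
    (hT : HasDeg h 0 T) (hgap : ∀ i j, 0 < h i - h j → d ≤ h i - h j) :
    HasDeg h d ⁅diagonal fun i => (h i : ℂ), T⁆ := by
  intro i j hij
  rw [lie_diagonal_apply]
  obtain hneg | hzero | hpos := lt_trichotomy (h i - h j) 0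
  · rw [hT i j hneg, mul_zero]
  · rw [← Complex.ofReal_sub, hzero, Complex.ofReal_zero, zero_mul]
  · exact absurd hij (hgap i j hpos).not_gt

theorem sq_div_normSq_diagonal_le_K_of_mem_orbit_diagonal {h : Fin n → ℝ} {d : ℝ}
    {C : Matrix (Fin n) (Fin n) ℂ} (hd : 0 < d) (hgap : ∀ i j, 0 < h i - h j → d ≤ h i - h j)
    (hC : C ∈ orbit (diagonal fun i => (h i : ℂ))) (hD : 0 < gramDet C) :
    d ^ 2 / normSq (diagonal fun i => (h i : ℂ)) ≤ K C := by
  obtain ⟨U, hU, T, S, hTS, hT, hS, rfl⟩ := exists_hasDeg_zero_unitary_conj_of_mem_orbit hC h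
  rw [gramDet_unitary_conj hU] at hD
  rw [K_unitary_conj hU]
  set D : Matrix (Fin n) (Fin n) ℂ := diagonal fun i => (h i : ℂ)
  have hN : HasDeg h d ((-1 : ℂ) • (⁅D, T⁆ * S)) := by
    simpa only [add_zero] using ((hasDeg_lie_diagonal hT hgap).mul hS).smul (-1)
  have hTDS : T * D * S = D + (-1 : ℂ) • (⁅D, T⁆ * S) := by
    rw [Ring.lie_def, Matrix.sub_mul, Matrix.mul_assoc D, hTS, Matrix.mul_one, neg_one_smul]
    abel
  rw [hTDS] at hD ⊢
  exact sq_div_normSq_le_K hD (hN.sq_mul_gramDet_diagonal_add_le hd)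

theorem IsRaising.K_sl2Comb_eq_div_normSq_lie {E : Matrix (Fin n) (Fin n) ℂ} (hE : IsRaising E)
    {a b c : ℂ} (hD : 0 < gramDet (sl2Comb E a b c)) :
    K (sl2Comb E a b c) = 2 ^ 2 / normSq ⁅E, Eᴴ⁆ := by
  rw [hE.K_sl2Comb hD, hE.normSq_lie_conjTranspose]
  ring

end OrbitBounds

section UnitGap

variable {n : ℕ} {D N : Matrix (Fin n) (Fin n) ℂ} {h : Fin n → ℝ}

theorem add_mem_orbit_of_lie_eq (hNN : N * N = 0) (hDN : ⁅D, N⁆ = N) : D + N ∈ orbit D := by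
  convert mul_mul_mem_orbit (P := 1 - N) (Q := 1 + N) ?_ D using 1
  · have hND : D * N = N + N * D := eq_add_of_sub_eq hDN
    have hNDN : N * (D * N) = 0 := by
      rw [hND, Matrix.mul_add, ← Matrix.mul_assoc, hNN, Matrix.zero_mul, add_zero]
    rw [Matrix.sub_mul, Matrix.one_mul, Matrix.mul_add, Matrix.mul_one, Matrix.sub_mul,
      Matrix.mul_assoc, hNDN, hND]
    abel
  · rw [Matrix.sub_mul, Matrix.mul_add, Matrix.mul_add, hNN]
    simp

theorem IsRaising.normSq_lie_add (hN : IsRaising N) (hD : Dᴴ = D) (hDN : ⁅D, N⁆ = N) :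
    normSq ⁅D + N, (D + N)ᴴ⁆ = 4 * normSq N := by
  have hDN' : ⁅D, Nᴴ⁆ = -Nᴴ := by
    have h := congrArg Matrix.conjTranspose hDN
    rw [conjTranspose_lie, hD, ← lie_skew] at h
    exact neg_eq_iff_eq_neg.mp h
  have hlie : ⁅D + N, (D + N)ᴴ⁆ = sl2Comb N 1 (-1) (-1) := by
    rw [conjTranspose_add, hD, add_lie, lie_add, lie_add, lie_self, hDN', ← lie_skew, hDN, sl2Comb]
    module
  rw [hlie, hN.normSq_sl2Comb]
  norm_num
  ring

theorem hasDeg_of_lie_diagonal_eq_smul {d : ℝ}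
    (hN : ⁅diagonal fun i => (h i : ℂ), N⁆ = (d : ℂ) • N) : HasDeg h d N := by
  intro i j hij
  have hentry := congrFun₂ hN i j
  rw [lie_diagonal_apply, Matrix.smul_apply, smul_eq_mul, ← Complex.ofReal_sub] at hentry
  by_contra h0
  exact hij.ne (Complex.ofReal_injective (mul_right_cancel₀ h0 hentry))

theorem exists_isRaising_of_sub_eq_one {i j : Fin n} (hij : h i - h j = 1) :
    ∃ N : Matrix (Fin n) (Fin n) ℂ,
      IsRaising N ∧ N ≠ 0 ∧ N * N = 0 ∧ ⁅diagonal fun i => (h i : ℂ), N⁆ = N := by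
  have hne : i ≠ j := by
    rintro rfl
    simp at hij
  refine ⟨single i j 1, ?_, fun h0 => ?_, single_mul_single_of_ne _ _ _ _ hne.symm _, ?_⟩
  · simp [IsRaising, Ring.lie_def, Matrix.sub_mul, Matrix.mul_sub, hne.symm, two_smul]
  · simpa using congrFun₂ h0 i j
  · ext k l
    rw [lie_diagonal_apply, single_apply]
    split_ifs with hkl
    · rw [← hkl.1, ← hkl.2, ← Complex.ofReal_sub, hij, Complex.ofReal_one, one_mul]
    · rw [mul_zero]

theorem exists_mem_orbit_diagonal_K_lt {i j : Fin n} (hij : h i - h j = 1) :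
    ∃ C ∈ orbit (diagonal fun i => (h i : ℂ)),
      0 < gramDet C ∧ K C < 2 ^ 2 / normSq (diagonal fun i => (h i : ℂ)) := by
  obtain ⟨N, hN, hN0, hNN, hDN⟩ := exists_isRaising_of_sub_eq_one hij
  have hdeg : HasDeg h 1 N :=
    hasDeg_of_lie_diagonal_eq_smul (by rw [Complex.ofReal_one, one_smul, hDN])
  have hD := hdeg.gramDet_diagonal_add one_pos
  have hlie := hN.normSq_lie_add (conjTranspose_diagonal_ofReal h) hDN
  refine ⟨_, add_mem_orbit_of_lie_eq hNN hDN, ?_⟩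
  set D : Matrix (Fin n) (Fin n) ℂ := diagonal fun i => (h i : ℂ)
  have hNpos : 0 < normSq N := normSq_pos.mpr hN0
  have hDpos : 0 < normSq D := normSq_pos.mpr fun h0 => hN0 (by rw [← hDN, h0, zero_lie])
  rw [K_eq_div_gramDet, hlie, hD, div_lt_div_iff₀ (by positivity) hDpos]
  refine ⟨by positivity, ?_⟩
  have : 0 < normSq N * (normSq D + normSq N) := by positivity
  linarith

end UnitGap

section StandardMinima

variable {n : ℕ} {π : n.Partition}

theorem hasDeg_stdE (π : n.Partition) : HasDeg (weight π) 2 (stdE π) :=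
  hasDeg_of_lie_diagonal_eq_smul <| by
    rw [← lie_stdE_conjTranspose, isRaising_stdE π, Complex.ofReal_ofNat]

theorem isNilpotent_stdE (π : n.Partition) : IsNilpotent (stdE π) :=
  (hasDeg_stdE π).isNilpotent two_pos

theorem exists_weight_eq (π : n.Partition) (i : Fin n) :
    ∃ m ∈ π.parts, ∃ k : ℕ, weight π i = (m : ℝ) - 1 - 2 * k :=
  ⟨_, (Multiset.mem_sort _).mp (List.get_mem (sortedParts π) ((blockEquiv π).symm i).1), _, rfl⟩

theorem exists_index_of_weight {m k : ℕ} (hm : m ∈ π.parts) (hk : k < m) :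
    ∃ i, weight π i = (m : ℝ) - 1 - 2 * k := by
  have hm' : m ∈ sortedParts π := by rwa [sortedParts, Multiset.mem_sort]
  obtain ⟨p, rfl⟩ := List.get_of_mem hm'
  exact ⟨blockEquiv π ⟨p, ⟨k, hk⟩⟩, by rw [weight, Equiv.symm_apply_apply]⟩

theorem IsEvenType.two_le_weight_sub (hπ : IsEvenType π) (i j : Fin n)
    (hij : 0 < weight π i - weight π j) : 2 ≤ weight π i - weight π j := by
  obtain ⟨a, ha, k, hk⟩ := exists_weight_eq π i
  obtain ⟨b, hb, l, hl⟩ := exists_weight_eq π j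
  have heven : Even ((a : ℤ) - b) := by
    rw [Int.even_sub, Int.even_coe_nat, Int.even_coe_nat]
    exact hπ a ha b hb
  have hsub : weight π i - weight π j = (((a : ℤ) - b - 2 * k + 2 * l : ℤ) : ℝ) := by
    rw [hk, hl]
    push_cast
    ring
  rw [hsub] at hij ⊢
  obtain ⟨c, hc⟩ := heven
  have hpos : 0 < (a : ℤ) - b - 2 * k + 2 * l := by exact_mod_cast hij
  exact_mod_cast (by lia : 2 ≤ (a : ℤ) - b - 2 * k + 2 * l)

theorem exists_weight_sub_eq_one_of_not_isEvenType (hπ : ¬ IsEvenType π) :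
    ∃ i j, weight π i - weight π j = 1 := by
  obtain ⟨a, ha, b, hb, haeven, hbodd⟩ : ∃ a ∈ π.parts, ∃ b ∈ π.parts, Even a ∧ ¬ Even b := by
    by_contra! h
    exact hπ fun a ha b hb => ⟨h a ha b hb, h b hb a ha⟩
  have ha0 := π.parts_pos ha
  obtain ⟨k, rfl⟩ := haeven
  obtain ⟨l, rfl⟩ := Nat.not_even_iff_odd.mp hbodd
  obtain ⟨i, hi⟩ := exists_index_of_weight ha (k := k - 1) (by lia)
  obtain ⟨j, hj⟩ := exists_index_of_weight hb (k := l) (by lia)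
  refine ⟨i, j, ?_⟩
  rw [hi, hj, Nat.cast_sub (by lia)]
  push_cast
  ring

variable {B : Matrix (Fin n) (Fin n) ℂ}

theorem gramDet_pos_of_isNilpotent (hB0 : B ≠ 0) (hnil : IsNilpotent B) : 0 < gramDet B := by
  have htr : (B ^ 2).trace = 0 :=
    (isNilpotent_trace_of_isNilpotent (hnil.pow_of_pos two_ne_zero)).eq_zero
  have hpos := normSq_pos.mpr hB0
  rw [gramDet, htr, norm_zero, zero_pow two_ne_zero, sub_zero]
  positivity

theorem K_of_mem_stdSl2 (hB : B ∈ stdSl2 π) (hD : 0 < gramDet B) :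
    K B = 2 ^ 2 / normSq (diagonal fun i => (weight π i : ℂ)) := by
  obtain ⟨a, b, c, rfl⟩ := mem_stdSl2_iff.mp hB
  rw [← lie_stdE_conjTranspose, (isRaising_stdE π).K_sl2Comb_eq_div_normSq_lie hD]

theorem stdE_ne_zero_of_mem_stdSl2 (hB : B ∈ stdSl2 π) (hB0 : B ≠ 0) : stdE π ≠ 0 := by
  obtain ⟨a, b, c, rfl⟩ := mem_stdSl2_iff.mp hB
  rintro h0
  exact hB0 (by simp [sl2Comb, h0])

theorem attainsMin_of_isNilpotent (hB : B ∈ stdSl2 π) (hB0 : B ≠ 0) (hnil : IsNilpotent B) :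
    AttainsMin B := by
  have hD := gramDet_pos_of_isNilpotent hB0 hnil
  refine (attainsMin_iff (trace_eq_zero_of_mem_stdSl2 hB)).mpr ⟨hD, fun C hC hCD => ?_⟩
  rw [K_of_mem_stdSl2 hB hD]
  have hE0 := stdE_ne_zero_of_mem_stdSl2 hB hB0
  obtain ⟨a, b, c, rfl⟩ := mem_stdSl2_iff.mp hB
  have habc := ((isRaising_stdE π).isNilpotent_sl2Comb_iff hE0 (isNilpotent_stdE π)).mp hnil
  obtain ⟨r, hr⟩ := (isRaising_stdE π).exists_smul_mem_orbit (isNilpotent_stdE π) habc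
  rw [← orbit_eq_of_mem hr] at hC
  exact ((hasDeg_stdE π).smul r).sq_div_normSq_diagonal_le_K two_pos.le hC hCD

theorem exists_smul_diagonal_weight_mem_orbit (hB : B ∈ stdSl2 π) (hnil : ¬ IsNilpotent B) :
    ∃ r : ℂ, r ≠ 0 ∧ r • diagonal (fun i => (weight π i : ℂ)) ∈ orbit B := by
  have hE0 := stdE_ne_zero_of_mem_stdSl2 hB fun h0 => hnil (h0 ▸ IsNilpotent.zero)
  obtain ⟨a, b, c, rfl⟩ := mem_stdSl2_iff.mp hB
  rw [← lie_stdE_conjTranspose]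
  refine (isRaising_stdE π).exists_smul_lie_mem_orbit (isNilpotent_stdE π) fun habc => hnil ?_
  exact ((isRaising_stdE π).isNilpotent_sl2Comb_iff hE0 (isNilpotent_stdE π)).mpr habc

theorem attainsMin_iff_isEvenType (hB : B ∈ stdSl2 π) (hnil : ¬ IsNilpotent B)
    (hD : 0 < gramDet B) : AttainsMin B ↔ IsEvenType π := by
  rw [attainsMin_iff (trace_eq_zero_of_mem_stdSl2 hB), K_of_mem_stdSl2 hB hD]
  obtain ⟨r, hr0, hr⟩ := exists_smul_diagonal_weight_mem_orbit hB hnil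
  rw [← orbit_eq_of_mem hr]
  constructor
  · rintro ⟨-, hmin⟩
    by_contra hπ
    obtain ⟨i, j, hij⟩ := exists_weight_sub_eq_one_of_not_isEvenType hπ
    obtain ⟨C, hC, hCD, hK⟩ := exists_mem_orbit_diagonal_K_lt hij
    have hle := hmin (r • C) (smul_mem_orbit r hC) (gramDet_smul_pos hr0 hCD)
    rw [K_smul hr0] at hle
    exact hK.not_ge hle
  · refine fun hπ => ⟨hD, fun C hC hCD => ?_⟩
    have hC' := smul_mem_orbit r⁻¹ hC
    rw [inv_smul_smul₀ hr0] at hC'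
    rw [← K_smul (inv_ne_zero hr0)]
    exact sq_div_normSq_diagonal_le_K_of_mem_orbit_diagonal two_pos hπ.two_le_weight_sub hC'
      (gramDet_smul_pos (inv_ne_zero hr0) hCD)

theorem K_eq_typeConst (hB : B ∈ stdSl2 π) (hZ : B ∉ Z n) :
    K B = typeConst π ∧
      typeConst π = 12 / (π.parts.map fun m : ℕ => (m : ℝ) * ((m : ℝ) ^ 2 - 1)).sum := by
  have hD := (notMem_Z_iff (trace_eq_zero_of_mem_stdSl2 hB)).mp hZ
  obtain ⟨a, b, c, rfl⟩ := mem_stdSl2_iff.mp hB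
  have hE := isRaising_stdE π
  have htype : typeConst π = 2 / normSq (stdE π) := hE.K₀_eq (hE.normSq_pos_of_gramDet_pos hD)
  rw [hE.K_sl2Comb hD, htype, normSq_stdE]
  exact ⟨rfl, by field_simp; norm_num⟩

end StandardMinima

section ConjugateMinima

variable {n : ℕ} {A : Matrix (Fin n) (Fin n) ℂ} {π : n.Partition}

theorem AttainsMin.exists_suConjInto (h : AttainsMin A) (hA : A.trace = 0)
    (hW : ¬ ∃ B ∈ W n \ Z n, B ∈ orbit A) : ∃ π : n.Partition, SUConjInto A (stdSl2 π) := by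
  obtain ⟨E, hE, hE0, hgen⟩ := (h.isCriticalPoint hA).exists_isRaising hA hW
  exact IsSUConjToStd.exists_suConjInto (hgen ▸ hE.isSUConjToStd hE0)

theorem SUConjInto.attainsMin_of_isNilpotent (h : SUConjInto A (stdSl2 π)) (hA0 : A ≠ 0)
    (hnil : IsNilpotent A) : AttainsMin A := by
  obtain ⟨U, hU, B, hB, rfl⟩ := h
  have hU' := (mem_specialUnitaryGroup_iff.mp hU).1
  rw [attainsMin_unitary_conj hU' (trace_eq_zero_of_mem_stdSl2 hB)]
  refine NessSl2.attainsMin_of_isNilpotent hB (fun h0 => hA0 ?_) ?_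
  · rw [h0, Matrix.mul_zero, Matrix.zero_mul]
  · exact isNilpotent_of_mem_orbit (mem_orbit_symm (unitary_conj_mem_orbit hU' B)) hnil

theorem SUConjInto.attainsMin_iff_isEvenType (h : SUConjInto A (stdSl2 π))
    (hnil : ¬ IsNilpotent A) (hD : 0 < gramDet A) : AttainsMin A ↔ IsEvenType π := by
  obtain ⟨U, hU, B, hB, rfl⟩ := h
  have hU' := (mem_specialUnitaryGroup_iff.mp hU).1
  rw [gramDet_unitary_conj hU'] at hD
  rw [attainsMin_unitary_conj hU' (trace_eq_zero_of_mem_stdSl2 hB)]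
  exact NessSl2.attainsMin_iff_isEvenType hB
    (fun hB' => hnil (isNilpotent_of_mem_orbit (unitary_conj_mem_orbit hU' B) hB')) hD

theorem attainsMin_iff_exists_suConjInto_of_isNilpotent (hA0 : A ≠ 0) (hnil : IsNilpotent A)
    (hW : ¬ ∃ B ∈ W n \ Z n, B ∈ orbit A) :
    AttainsMin A ↔ ∃ π : n.Partition, SUConjInto A (stdSl2 π) :=
  ⟨fun h => h.exists_suConjInto (isNilpotent_trace_of_isNilpotent hnil).eq_zero hW,
    fun ⟨_, hπ⟩ => hπ.attainsMin_of_isNilpotent hA0 hnil⟩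

theorem attainsMin_iff_exists_isEvenType_of_not_isNilpotent (hA : A.trace = 0)
    (hnil : ¬ IsNilpotent A) (hW : ¬ ∃ B ∈ W n \ Z n, B ∈ orbit A) :
    AttainsMin A ↔ A ∉ Z n ∧ ∃ π : n.Partition, IsEvenType π ∧ SUConjInto A (stdSl2 π) := by
  constructor
  · intro h
    obtain ⟨π, hπ⟩ := h.exists_suConjInto hA hW
    exact ⟨h.1.2, π, (hπ.attainsMin_iff_isEvenType hnil ((notMem_Z_iff hA).mp h.1.2)).mp h, hπ⟩
  · rintro ⟨hZ, π, heven, hπ⟩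
    exact (hπ.attainsMin_iff_isEvenType hnil ((notMem_Z_iff hA).mp hZ)).mpr heven

end ConjugateMinima

end NessSl2

open NessSl2

theorem mainTheorem2 (n : ℕ) (A : Matrix (Fin n) (Fin n) ℂ) (hA : A.trace = 0)
    (hscalar : ¬ ∃ c : ℂ, A = c • (1 : Matrix (Fin n) (Fin n) ℂ))
    (hW : ¬ ∃ B ∈ NessSl2.W n \ NessSl2.Z n, B ∈ NessSl2.orbit A) :
    -- (1) critical points
    (NessSl2.IsCriticalPoint A ↔
      Module.finrank ℂ (NessSl2.genAlg A) = 3 ∧ NessSl2.IsSUConjToStd (NessSl2.genAlg A)) ∧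
    -- (2) the value on the standard subalgebras
    (∀ π : n.Partition, ∀ B ∈ NessSl2.stdSl2 π, B ∉ NessSl2.Z n →
      NessSl2.K B = NessSl2.typeConst π ∧
      NessSl2.typeConst π = 12 / (π.parts.map fun m : ℕ => (m : ℝ) * ((m : ℝ) ^ 2 - 1)).sum) ∧
    -- (3) minimum on nilpotent orbits
    (IsNilpotent A →
      (NessSl2.AttainsMin A ↔ ∃ π : n.Partition, NessSl2.SUConjInto A (NessSl2.stdSl2 π))) ∧
    -- (4) minimum on the other orbits
    (¬ IsNilpotent A →
      (NessSl2.AttainsMin A ↔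
        A ∉ NessSl2.Z n ∧
          ∃ π : n.Partition, NessSl2.IsEvenType π ∧
            NessSl2.SUConjInto A (NessSl2.stdSl2 π))) := by
  have hA0 : A ≠ 0 := fun h0 => hscalar ⟨0, by rw [h0, zero_smul]⟩
  exact ⟨isCriticalPoint_iff_isSUConjToStd hA0 hA hW, fun π B hB hZ => K_eq_typeConst hB hZ,
    fun hnil => attainsMin_iff_exists_suConjInto_of_isNilpotent hA0 hnil hW,
    fun hnil => attainsMin_iff_exists_isEvenType_of_not_isNilpotent hA hnil hW⟩
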